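/- Let $\mu$ be a $\sigma$-finite measure on $\mathbb{R}$ and $d\ge 1$ an integer. For a subset $T$ of a metric space and $\epsilon>0$, let $N(\epsilon,T)$ be the minimal number of balls of radius $\epsilon$ needed to cover $T$, and let ${\cal H}(\epsilon,T):=\log N(\epsilon,T)$. For functions $h,g$ of $\epsilon$ with $g>0$ near $0$, write $h(\epsilon)\lesssim g(\epsilon)$ if $\limsup_{\epsilon\downarrow 0}h(\epsilon)/g(\epsilon)<\infty$. Let $\Psi=\{\psi_v:\ v\in[0,1]\}\subset L_2(\mu)$ be a collection of real functions with $L_2(\mu)$-norm at most $1$, and suppose that for some constant $V>0$ $$N(\epsilon,\Psi)\lesssim\epsilon^{-V}.$$ Let $\{{\cal V}_k\}_{k\ge 0}$ be a nested sequence of approximations of $\Psi$ with parameters $(q,\gamma,W)$, where $q\ge 1$ is an integer and $\gamma,W>0$; that is, ${\cal V}_0\subset{\cal V}_1\subset\cdots$ are linear subspaces of $L_2(\mu)$ with $\dim({\cal V}_k)=q2^k$ for all $k\ge 0$, and for all $k\ge 1$ and all $v\in[0,1]$ $$\min_{f\in{\cal V}_k}\int(\psi_v-f)^2\,d\mu\le\gamma^2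 2^{-2k/W}.$$ Let ${\cal F}:={\rm absconv}(\Psi\otimes\cdots\otimes\Psi)\subset L_2(\mu\times\cdots\times\mu)$ ($d$ factors) be the closure in $L_2(\mu\times\cdots\times\mu)$ of the set of all functions $$(u_1,\ldots,u_d)\mapsto\sum_{v_1\in V_1}\cdots\sum_{v_d\in V_d}\beta_{v_1,\ldots,v_d}\,\psi_{v_1}(u_1)\cdots\psi_{v_d}(u_d),$$ where $V_1,\ldots,V_d$ are finite subsets of $[0,1]$ and the $\beta_{v_1,\ldots,v_d}$ are real numbers with $\sum_{v_1\in V_1,\ldots,v_d\in V_d}|\beta_{v_1,\ldots,v_d}|\le 1$. Then $${\cal H}(\epsilon,{\cal F})\lesssim\epsilon^{-\frac{2W}{2+W}}\,\log^{d-1}(1/\epsilon)\,\log^{\frac{W}{2+W}}(1/\epsilon).$$ -/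

import Mathlib

open MeasureTheory Filter Topology
open scoped ENNReal NNReal

noncomputable section

namespace TensorEntropy

/-- The order relation `h ≲ g` as `ε ↓ 0`: `limsup_{ε ↓ 0} h(ε) / g(ε) < ∞`.
The function `h` may take the value `∞`. -/
def LesssimZero (h : ℝ → EReal) (g : ℝ → ℝ) : Prop :=
  limsup (fun ε : ℝ => h ε / (g ε : EReal)) (𝓝[>] (0 : ℝ)) < ⊤

/-- The covering number `N(ε, T)` of a subset `T` of a metric space: the minimal number (possibly
`∞`) of closed balls of radius `ε`, centred anywhere in the metric space, that cover `T`. -/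
def coveringNum {E : Type*} [PseudoMetricSpace E] (T : Set E) (ε : ℝ) : ℝ≥0∞ :=
  ((Metric.externalCoveringNumber ε.toNNReal T : ℕ∞) : ℝ≥0∞)

/-- The entropy `H(ε, T) = log N(ε, T)`. -/
def entropy {E : Type*} [PseudoMetricSpace E] (T : Set E) (ε : ℝ) : EReal :=
  ENNReal.log (coveringNum T ε)

theorem memLp_tensor (μ : Measure ℝ) [SigmaFinite μ] {d : ℕ} (f : Fin d → Lp ℝ 2 μ) :
    MemLp (fun u : Fin d → ℝ => ∏ i, f i (u i)) 2 (Measure.pi fun _ : Fin d => μ) := by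
  have hm : AEStronglyMeasurable (fun u : Fin d → ℝ => ∏ i, f i (u i))
      (Measure.pi fun _ : Fin d => μ) :=
    Finset.aestronglyMeasurable_fun_prod _ fun i _ =>
      (Lp.aestronglyMeasurable (f i)).comp_quasiMeasurePreserving
        (Measure.quasiMeasurePreserving_eval (fun _ : Fin d => μ) i)
  rw [memLp_two_iff_integrable_sq hm]
  have h := Integrable.fintype_prod (ι := Fin d) (μ := fun _ => μ)
    (f := fun i x => (f i x) ^ 2) fun i => (Lp.memLp (f i)).integrable_sq
  simpa [Finset.prod_pow] using h

/-- The elementary tensor `f₁ ⊗ ⋯ ⊗ f_d ∈ L₂(μ × ⋯ × μ)`, that is, the (class of the) function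
`(u₁, …, u_d) ↦ f₁(u₁) ⋯ f_d(u_d)`. -/
def tensor (μ : Measure ℝ) [SigmaFinite μ] {d : ℕ} (f : Fin d → Lp ℝ 2 μ) :
    Lp ℝ 2 (Measure.pi fun _ : Fin d => μ) :=
  (memLp_tensor μ f).toLp _

/-- The absolute convex hull of the `d`-fold tensor `Ψ ⊗ ⋯ ⊗ Ψ`: the closure in
`L₂(μ × ⋯ × μ)` of the set of all sums
`∑_{v ∈ V₁ × ⋯ × V_d} β_v ψ_{v₁} ⊗ ⋯ ⊗ ψ_{v_d}`, with `V₁, …, V_d` finite subsets of the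
parameter space and `∑_{v ∈ V₁ × ⋯ × V_d} |β_v| ≤ 1`. -/
def absconvTensor {Θ : Type*} (μ : Measure ℝ) [SigmaFinite μ] (d : ℕ) (ψ : Θ → Lp ℝ 2 μ) :
    Set (Lp ℝ 2 (Measure.pi fun _ : Fin d => μ)) :=
  closure {f | ∃ (V : Fin d → Finset Θ) (β : (Fin d → Θ) → ℝ),
    ∑ v ∈ Fintype.piFinset V, |β v| ≤ 1 ∧
    f = ∑ v ∈ Fintype.piFinset V, β v • tensor μ fun i => ψ (v i)}

/-- `(V_k)_{k ≥ 0}` is a nested sequence of approximations of `Ψ = {ψ_v}` in `L₂(μ)` with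
parameters `(q, γ, W)`: it is an increasing sequence of linear subspaces with
`dim V_k = q 2^k`, and, for all `k ≥ 1` and all `v`, the minimum over `f ∈ V_k` of
`∫ (ψ_v - f)² dμ` is at most `γ² 2^{-2k/W}`. -/
structure IsNestedApprox {Θ : Type*} {μ : Measure ℝ} (ψ : Θ → Lp ℝ 2 μ) (q : ℕ) (γ W : ℝ)
    (V : ℕ → Submodule ℝ (Lp ℝ 2 μ)) : Prop where
  q_pos : 1 ≤ q
  γ_pos : 0 < γ
  W_pos : 0 < W
  nested : Monotone V
  finrank_eq : ∀ k : ℕ, Module.finrank ℝ (V k) = q * 2 ^ k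
  approx : ∀ k : ℕ, 1 ≤ k → ∀ v : Θ, ∃ f ∈ V k,
    ∫ u, (ψ v u - f u) ^ 2 ∂μ ≤ γ ^ 2 * (2 : ℝ) ^ (-(2 * (k : ℝ) / W))

end TensorEntropy

end

/-!
By Maurey's argument, the absolutely convex hull of `A` points of norm at most `δ` in a Hilbert
space has entropy at most `m log (2A)` at radius `δ / √m`; if the points lie in a subspace of
dimension `D`, each further halving of the radius costs at most `D log 5`.

Put `p = 2W / (2 + W)` and `τ = 2 ^ (-1 / p)`, so that `2 ^ (-1 / W) = √2 τ`. Up to an error of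
order `τ ^ K`, every `ψ_v` may be replaced by the projection onto a fixed `V_N` of one of
`exp (O(K))` points of `Ψ`. Expand each projection into its increments along `V_0 ⊂ V_1 ⊂ ⋯`, and
group the terms of the tensor product by total degree `j = k₁ + ⋯ + k_d`. The part of degree
`j < K` is an orthogonal sum of at most `K ^ (d - 1)` terms: its norm is
`O(K ^ ((d - 1) / 2) (√2 τ) ^ j)`, and it varies in a space of dimension `O(K ^ (d - 1) 2 ^ j)`.
Averaging over `m ≈ 2 ^ j K ^ (d - 1) / K` points covers the corresponding hull at radius
`O(√K τ ^ j)` with entropy `O(2 ^ j K ^ (d - 1))`, and `O(K - j)` halvings bring the radius down to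
`√K τ ^ K 2 ^ (-(K - j))`. The parts of degree at least `K` are covered together by averaging alone.
Radii and entropies are summable in `K - j`, so that the entropy at radius `O(√K τ ^ K)` is
`O(2 ^ K K ^ (d - 1))`, and the theorem is the case `2 ^ K ≈ (√(log (1 / ε)) / ε) ^ p`.
-/

open scoped Pointwise

namespace TensorEntropy

section Entropy

theorem exists_isCover_encard_eq {E : Type*} [PseudoMetricSpace E] (ε : ℝ≥0) (S : Set E) :
    ∃ C : Set E, Metric.IsCover ε S C ∧ C.encard = Metric.externalCoveringNumber ε S := by
  have : Nonempty {C : Set E // Metric.IsCover ε S C} := ⟨⟨S, Metric.IsCover.refl ε S⟩⟩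
  obtain ⟨C, hC⟩ := ciInf_mem fun C : {C : Set E // Metric.IsCover ε S C} => C.1.encard
  exact ⟨C, C.2, hC.trans iInf_subtype⟩

theorem entropy_mono_set {E : Type*} [PseudoMetricSpace E] {S T : Set E} (h : S ⊆ T) (ε : ℝ) :
    entropy S ε ≤ entropy T ε :=
  ENNReal.log_monotone <| ENat.toENNReal_mono <| Metric.externalCoveringNumber_mono_set h

theorem entropy_anti {E : Type*} [PseudoMetricSpace E] (T : Set E) {ε ε' : ℝ} (h : ε ≤ ε') :
    entropy T ε' ≤ entropy T ε :=
  ENNReal.log_monotone <| ENat.toENNReal_mono <|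
    Metric.externalCoveringNumber_anti <| Real.toNNReal_mono h

theorem entropy_closure_le {E : Type*} [PseudoMetricSpace E] (S : Set E) (ε : ℝ) :
    entropy (closure S) ε ≤ entropy S ε := by
  obtain ⟨C, hC, hcard⟩ := exists_isCover_encard_eq ε.toNNReal S
  refine ENNReal.log_monotone <| ENat.toENNReal_mono ?_
  rcases C.finite_or_infinite with hfin | hinf
  · rw [Metric.isCover_iff_subset_iUnion_closedBall] at hC
    have hclosed : IsClosed (⋃ c ∈ C, Metric.closedBall c ε.toNNReal) :=
      hfin.isClosed_biUnion fun c _ => Metric.isClosed_closedBall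
    exact (Metric.isCover_iff_subset_iUnion_closedBall.2
      (closure_minimal hC hclosed)).externalCoveringNumber_le_encard.trans_eq hcard
  · exact le_top.trans_eq (hinf.encard_eq.symm.trans hcard)

theorem entropy_image_le {E F : Type*} [PseudoMetricSpace E] [PseudoMetricSpace F] {f : E → F}
    (hf : LipschitzWith 1 f) (S : Set E) (ε : ℝ) : entropy (f '' S) ε ≤ entropy S ε := by
  obtain ⟨C, hC, hcard⟩ := exists_isCover_encard_eq ε.toNNReal S
  have hfC : Metric.IsCover ε.toNNReal (f '' S) (f '' C) := by
    simpa only [one_mul] using hC.image_lipschitz hf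
  exact ENNReal.log_monotone <| ENat.toENNReal_mono <|
    hfC.externalCoveringNumber_le_encard.trans <| (Set.encard_image_le f C).trans_eq hcard

theorem entropy_le_log_card {E A : Type*} [PseudoMetricSpace E] [Fintype A] {S : Set E} {ε : ℝ}
    (c : A → E) (h : ∀ x ∈ S, ∃ a, dist x (c a) ≤ ε) :
    entropy S ε ≤ (Real.log (Fintype.card A) : EReal) := by
  have hcover : Metric.IsCover ε.toNNReal S (Set.range c) := fun x hx =>
    (h x hx).elim fun a ha => ⟨c a, Set.mem_range_self a, by
      simpa only [edist_dist] using! ENNReal.ofReal_le_ofReal ha⟩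
  have hcard : coveringNum S ε ≤ ENNReal.ofReal (Fintype.card A) := by
    rw [← Set.image_univ] at hcover
    have h := hcover.externalCoveringNumber_le_encard.trans (Set.encard_image_le c Set.univ)
    simpa [coveringNum] using ENat.toENNReal_mono h
  refine (ENNReal.log_monotone hcard).trans ?_
  rcases (Fintype.card A).eq_zero_or_pos with h0 | hpos
  · simp [h0]
  · rw [ENNReal.log_ofReal_of_pos (by exact_mod_cast hpos)]

theorem exists_finset_of_entropy_le {E : Type*} [PseudoMetricSpace E] {S : Set E} {ε B : ℝ}
    (hε : 0 ≤ ε) (h : entropy S ε ≤ B) :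
    ∃ C : Finset E, (C.card : ℝ) ≤ Real.exp B ∧ ∀ x ∈ S, ∃ c ∈ C, dist x c ≤ ε := by
  obtain ⟨C, hC, hcard⟩ := exists_isCover_encard_eq ε.toNNReal S
  have hle : ((C.encard : ℕ∞) : ℝ≥0∞) ≤ ENNReal.ofReal (Real.exp B) := by
    rw [hcard, ← ENNReal.log_le_log_iff, ENNReal.log_ofReal_of_pos (Real.exp_pos _), Real.log_exp]
    exact h
  have hfin : C.Finite := by
    rw [← Set.encard_lt_top_iff, ← ENat.toENNReal_lt_top]
    exact hle.trans_lt ENNReal.ofReal_lt_top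
  refine ⟨hfin.toFinset, ?_, fun x hx => ?_⟩
  · rw [hfin.encard_eq_coe_toFinset_card] at hle
    simpa [ENNReal.natCast_le_ofReal, ENNReal.le_ofReal_iff_toReal_le, (Real.exp_pos B).le]
      using hle
  · obtain ⟨c, hcC, hxc⟩ := hC hx
    refine ⟨c, hfin.mem_toFinset.2 hcC, ?_⟩
    have hxc : edist x c ≤ ENNReal.ofReal ε := hxc
    rwa [edist_dist, ENNReal.ofReal_le_ofReal_iff hε] at hxc

theorem entropy_closedBall_self_le {E : Type*} [PseudoMetricSpace E] (x : E) (r : ℝ) :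
    entropy (Metric.closedBall x r) r ≤ 0 := by
  simpa using entropy_le_log_card (fun _ : Unit => x) fun y hy =>
    ⟨(), Metric.mem_closedBall.1 hy⟩

theorem entropy_add_le {E : Type*} [SeminormedAddCommGroup E] (S T : Set E) {ε δ : ℝ}
    (hε : 0 ≤ ε) (hδ : 0 ≤ δ) : entropy (S + T) (ε + δ) ≤ entropy S ε + entropy T δ := by
  obtain ⟨C, hC, hcardC⟩ := exists_isCover_encard_eq ε.toNNReal S
  obtain ⟨D, hD, hcardD⟩ := exists_isCover_encard_eq δ.toNNReal T
  have hcover : Metric.IsCover (ε + δ).toNNReal (S + T) (C + D) := by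
    rintro _ ⟨x, hx, y, hy, rfl⟩
    obtain ⟨c, hc, hxc⟩ := hC hx
    obtain ⟨e, he, hye⟩ := hD hy
    refine ⟨c + e, Set.add_mem_add hc he, ?_⟩
    rw [Real.toNNReal_add hε hδ]
    exact (edist_add_add_le x y c e).trans (by push_cast; exact add_le_add hxc hye)
  have hcard : (C + D).encard ≤ C.encard * D.encard := by
    rw [← Set.encard_prod, ← Set.add_image_prod]
    exact Set.encard_image_le _ _
  rw [entropy, entropy, entropy, ← ENNReal.log_mul_add]
  refine ENNReal.log_monotone ?_
  rw [coveringNum, coveringNum, coveringNum, ← ENat.toENNReal_mul, ← hcardC, ← hcardD]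
  exact ENat.toENNReal_mono (hcover.externalCoveringNumber_le_encard.trans hcard)

theorem entropy_add_closedBall_le {E : Type*} [SeminormedAddCommGroup E] (S : Set E) {ε δ : ℝ}
    (hε : 0 ≤ ε) (hδ : 0 ≤ δ) :
    entropy (S + Metric.closedBall 0 δ) (ε + δ) ≤ entropy S ε := by
  simpa only [add_zero] using
    (entropy_add_le S _ hε hδ).trans (add_le_add_right (entropy_closedBall_self_le 0 δ) _)

theorem entropy_sum_le {E ι : Type*} [SeminormedAddCommGroup E] (s : Finset ι) (S : ι → Set E)
    {ε B : ι → ℝ} (hε : ∀ j ∈ s, 0 ≤ ε j) (h : ∀ j ∈ s, entropy (S j) (ε j) ≤ B j) :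
    entropy (∑ j ∈ s, S j) (∑ j ∈ s, ε j) ≤ (∑ j ∈ s, B j : ℝ) := by
  classical
  induction s using Finset.induction_on with
  | empty =>
    simpa using! entropy_closedBall_self_le (0 : E) 0 |>.trans' (entropy_mono_set (by simp) 0)
  | insert i s hi ih =>
    rw [Finset.sum_insert hi, Finset.sum_insert hi, Finset.sum_insert hi, EReal.coe_add]
    rw [Finset.forall_mem_insert] at hε h
    exact (entropy_add_le _ _ hε.1 (Finset.sum_nonneg hε.2)).trans
      (add_le_add h.1 (ih hε.2 h.2))

theorem entropy_le_add_entropy_closedBall {E : Type*} [SeminormedAddCommGroup E] (S : Set E)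
    {ε δ : ℝ} (hε : 0 ≤ ε) (hδ : 0 ≤ δ) :
    entropy S δ ≤ entropy S ε + entropy (Metric.closedBall (0 : E) ε) δ := by
  obtain ⟨C, hC, hcard⟩ := exists_isCover_encard_eq ε.toNNReal S
  have hsub : S ⊆ C + Metric.closedBall 0 ε := fun x hx => by
    obtain ⟨c, hc, hxc⟩ := hC hx
    have hxc : edist x c ≤ ENNReal.ofReal ε := hxc
    refine ⟨c, hc, x - c, ?_, add_sub_cancel c x⟩
    rwa [mem_closedBall_zero_iff, ← dist_eq_norm, ← ENNReal.ofReal_le_ofReal_iff hε, ← edist_dist]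
  have hC0 : entropy C 0 ≤ entropy S ε := by
    refine ENNReal.log_monotone <| ENat.toENNReal_mono ?_
    exact (Metric.externalCoveringNumber_le_encard_self C).trans_eq hcard
  calc entropy S δ ≤ entropy (C + Metric.closedBall 0 ε) (0 + δ) := by
        simpa only [zero_add] using entropy_mono_set hsub δ
    _ ≤ _ := (entropy_add_le C _ le_rfl hδ).trans (add_le_add_left hC0 _)

end Entropy

section FiniteDimensional

variable {E : Type*} [NormedAddCommGroup E] [NormedSpace ℝ E] [FiniteDimensional ℝ E]

theorem packingNumber_closedBall_le {r : ℝ} (hr : 0 < r) :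
    Metric.packingNumber (r / 2).toNNReal (Metric.closedBall (0 : E) r) ≤
      (5 ^ Module.finrank ℝ E : ℕ) := by
  refine iSup_le fun C => iSup₂_le fun hCr hC => ?_
  by_contra! hlarge
  obtain ⟨t, htC, ht⟩ := Set.exists_subset_encard_eq (Order.add_one_le_of_lt hlarge)
  have htfin : t.Finite := Set.finite_of_encard_eq_coe (k := 5 ^ Module.finrank ℝ E + 1) ht
  lift t to Finset E using htfin
  have hcard : t.card = 5 ^ Module.finrank ℝ E + 1 := by
    rw [Set.encard_coe_eq_coe_finsetCard] at ht
    exact_mod_cast ht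
  have hscale (x : E) : ‖(2 / r) • x‖ = 2 / r * ‖x‖ := by
    rw [norm_smul, Real.norm_of_nonneg (by positivity)]
  have hinj : Function.Injective fun x : E => (2 / r) • x :=
    smul_right_injective E (by positivity)
  classical
  have hle := Besicovitch.card_le_of_separated (t.image fun x => (2 / r) • x)
    (by
      simp only [Finset.forall_mem_image, hscale]
      intro x hx
      rw [div_mul_eq_mul_div, div_le_iff₀ hr]
      nlinarith [mem_closedBall_zero_iff.1 (hCr (htC hx))])
    (by
      simp only [Finset.forall_mem_image, ← smul_sub, hscale]
      intro x hx y hy hxy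
      have hsep : ENNReal.ofReal (r / 2) < edist x y :=
        hC (htC hx) (htC hy) fun h => hxy (by rw [h])
      rw [edist_dist, ENNReal.ofReal_lt_ofReal_iff_of_nonneg (by positivity), dist_eq_norm] at hsep
      rw [div_mul_eq_mul_div, le_div_iff₀ hr]
      linarith)
  rw [Finset.card_image_of_injective t hinj, hcard] at hle
  omega

theorem entropy_closedBall_half_le {r : ℝ} (hr : 0 < r) :
    entropy (Metric.closedBall (0 : E) r) (r / 2) ≤
      (Module.finrank ℝ E * Real.log 5 : ℝ) := by
  have h := ENat.toENNReal_mono <|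
    (Metric.externalCoveringNumber_le_coveringNumber _ _).trans <|
      (Metric.coveringNumber_le_packingNumber _ _).trans (packingNumber_closedBall_le (E := E) hr)
  calc entropy (Metric.closedBall (0 : E) r) (r / 2)
      ≤ ENNReal.log (ENNReal.ofReal (5 ^ Module.finrank ℝ E)) := by
        refine ENNReal.log_monotone (h.trans_eq ?_)
        rw [ENNReal.ofReal_pow (by norm_num)]
        simp
    _ = (Module.finrank ℝ E * Real.log 5 : ℝ) := by
        rw [ENNReal.log_ofReal_of_pos (by positivity), Real.log_pow]

theorem entropy_div_two_pow_le (T : Set E) {ε : ℝ} (hε : 0 < ε) (s : ℕ) :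
    entropy T (ε / 2 ^ s) ≤ entropy T ε + (s * Module.finrank ℝ E * Real.log 5 : ℝ) := by
  induction s with
  | zero => simp
  | succ s ih =>
    have hs : 0 < ε / 2 ^ s := by positivity
    calc entropy T (ε / 2 ^ (s + 1)) = entropy T (ε / 2 ^ s / 2) := by rw [pow_succ, div_div]
      _ ≤ entropy T (ε / 2 ^ s) + entropy (Metric.closedBall (0 : E) (ε / 2 ^ s)) (ε / 2 ^ s / 2) :=
        entropy_le_add_entropy_closedBall T hs.le (by positivity)
      _ ≤ entropy T ε + (s * Module.finrank ℝ E * Real.log 5 : ℝ)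
          + (Module.finrank ℝ E * Real.log 5 : ℝ) :=
        add_le_add ih (entropy_closedBall_half_le hs)
      _ = entropy T ε + ((s + 1 : ℕ) * Module.finrank ℝ E * Real.log 5 : ℝ) := by
        rw [add_assoc, ← EReal.coe_add]
        congr 2
        push_cast
        ring

end FiniteDimensional

theorem image_absConvexHull {F G : Type*} [AddCommGroup F] [Module ℝ F] [AddCommGroup G]
    [Module ℝ G] (f : F →ₗ[ℝ] G) (S : Set F) :
    f '' absConvexHull ℝ S = absConvexHull ℝ (f '' S) := by
  rw [← convexHull_union_neg_eq_absConvexHull, ← convexHull_union_neg_eq_absConvexHull,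
    f.image_convexHull, Set.image_union, Set.image_neg]

section Maurey

variable {E : Type*} [NormedAddCommGroup E] [InnerProductSpace ℝ E]

/-- Some point of `P` does at least as well as the expectation over a random point of `P` with
mean `y`. -/
theorem exists_norm_add_sub_sq_le_of_mem_convexHull {P : Set E} {δ : ℝ}
    (hP : ∀ x ∈ P, ‖x‖ ≤ δ) {y : E} (hy : y ∈ convexHull ℝ P) (s : E) :
    ∃ x ∈ P, ‖s + (x - y)‖ ^ 2 ≤ ‖s‖ ^ 2 + δ ^ 2 := by
  have hconcave : ConcaveOn ℝ (convexHull ℝ P) fun x => inner ℝ (s - y) x :=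
    (innerₛₗ ℝ (s - y)).concaveOn (convex_convexHull ℝ P)
  obtain ⟨x, hxP, hx⟩ := hconcave.exists_le_of_mem_convexHull (subset_convexHull ℝ P) hy
  refine ⟨x, hxP, ?_⟩
  have hxδ : ‖x‖ ^ 2 ≤ δ ^ 2 := by gcongr; exact hP x hxP
  calc ‖s + (x - y)‖ ^ 2 = ‖(s - y) + x‖ ^ 2 := by congr 2; abel
    _ = ‖s - y‖ ^ 2 + 2 * inner ℝ (s - y) x + ‖x‖ ^ 2 := norm_add_sq_real _ _
    _ ≤ ‖s - y‖ ^ 2 + 2 * inner ℝ (s - y) y + δ ^ 2 := by gcongr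
    _ = ‖s‖ ^ 2 - ‖y‖ ^ 2 + δ ^ 2 := by
      rw [norm_sub_sq_real, inner_sub_left, real_inner_self_eq_norm_sq]
      ring
    _ ≤ ‖s‖ ^ 2 + δ ^ 2 := by nlinarith [sq_nonneg ‖y‖]

variable {A : Type*} {p : A → E} {δ : ℝ}

theorem exists_norm_sum_sub_sq_le_of_mem_convexHull (hp : ∀ a, ‖p a‖ ≤ δ) {y : E}
    (hy : y ∈ convexHull ℝ (Set.range p)) (m : ℕ) :
    ∃ f : Fin m → A, ‖∑ r, (p (f r) - y)‖ ^ 2 ≤ m * δ ^ 2 := by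
  induction m with
  | zero => exact ⟨Fin.elim0, by simp⟩
  | succ m ih =>
    obtain ⟨f, hf⟩ := ih
    obtain ⟨_, ⟨a, rfl⟩, ha⟩ := exists_norm_add_sub_sq_le_of_mem_convexHull
      (Set.forall_mem_range.2 hp) hy (∑ r, (p (f r) - y))
    refine ⟨Fin.snoc f a, ?_⟩
    rw [Fin.sum_univ_castSucc]
    simp only [Fin.snoc_castSucc, Fin.snoc_last]
    push_cast
    linarith

theorem exists_norm_sub_average_le (hp : ∀ a, ‖p a‖ ≤ δ) (hδ : 0 ≤ δ) {y : E}
    (hy : y ∈ convexHull ℝ (Set.range p)) {m : ℕ} (hm : 0 < m) :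
    ∃ f : Fin m → A, ‖y - (m : ℝ)⁻¹ • ∑ r, p (f r)‖ ≤ δ / √m := by
  obtain ⟨f, hf⟩ := exists_norm_sum_sub_sq_le_of_mem_convexHull hp hy m
  have hm' : (0 : ℝ) < m := Nat.cast_pos.2 hm
  have hsum : ‖∑ r, (p (f r) - y)‖ ≤ √m * δ := by
    refine abs_le_of_sq_le_sq' ?_ (by positivity) |>.2
    rwa [mul_pow, Real.sq_sqrt hm'.le]
  have heq : y - (m : ℝ)⁻¹ • ∑ r, p (f r) = -((m : ℝ)⁻¹ • ∑ r, (p (f r) - y)) := by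
    rw [Finset.sum_sub_distrib, smul_sub, Finset.sum_const, Finset.card_univ, Fintype.card_fin,
      ← Nat.cast_smul_eq_nsmul ℝ, inv_smul_smul₀ hm'.ne', neg_sub]
  refine ⟨f, ?_⟩
  calc ‖y - (m : ℝ)⁻¹ • ∑ r, p (f r)‖ = (m : ℝ)⁻¹ * ‖∑ r, (p (f r) - y)‖ := by
        rw [heq, norm_neg, norm_smul, norm_inv, Real.norm_natCast]
    _ ≤ (m : ℝ)⁻¹ * (√m * δ) := by gcongr
    _ = δ / √m := by
      rw [← mul_assoc, ← div_eq_inv_mul, Real.sqrt_div_self', one_div_mul_eq_div]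

theorem entropy_convexHull_range_le [Fintype A] (hp : ∀ a, ‖p a‖ ≤ δ) (hδ : 0 ≤ δ) {m : ℕ}
    (hm : 0 < m) :
    entropy (convexHull ℝ (Set.range p)) (δ / √m) ≤ (m * Real.log (Fintype.card A) : ℝ) := by
  have h := entropy_le_log_card (S := convexHull ℝ (Set.range p)) (ε := δ / √m)
    (fun f : Fin m → A => (m : ℝ)⁻¹ • ∑ r, p (f r)) fun y hy => by
      simpa only [dist_eq_norm] using exists_norm_sub_average_le hp hδ hy hm
  rwa [Fintype.card_fun, Fintype.card_fin, Nat.cast_pow, Real.log_pow] at h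

theorem entropy_absConvexHull_range_le [Fintype A] (hp : ∀ a, ‖p a‖ ≤ δ) (hδ : 0 ≤ δ) {m : ℕ}
    (hm : 0 < m) :
    entropy (absConvexHull ℝ (Set.range p)) (δ / √m) ≤
      (m * Real.log (2 * Fintype.card A) : ℝ) := by
  have hrange : Set.range (Sum.elim p (-p)) = Set.range p ∪ -Set.range p := by
    rw [Set.Sum.elim_range, ← Set.image_neg_eq_neg, ← Set.range_comp]
    rfl
  have h := entropy_convexHull_range_le (p := Sum.elim p (-p)) (δ := δ)
    (by simpa using hp) hδ hm
  rwa [hrange, convexHull_union_neg_eq_absConvexHull, Fintype.card_sum, ← two_mul, Nat.cast_mul,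
    Nat.cast_ofNat] at h

theorem entropy_absConvexHull_range_le_of_mem [Fintype A] (U : Submodule ℝ E)
    [FiniteDimensional ℝ U] (hU : ∀ a, p a ∈ U) (hp : ∀ a, ‖p a‖ ≤ δ) (hδ : 0 < δ) {m : ℕ}
    (hm : 0 < m) (s : ℕ) :
    entropy (absConvexHull ℝ (Set.range p)) (δ / √m / 2 ^ s) ≤
      (m * Real.log (2 * Fintype.card A) + s * Module.finrank ℝ U * Real.log 5 : ℝ) := by
  let pU : A → U := fun a => ⟨p a, hU a⟩
  have himage : absConvexHull ℝ (Set.range p) = U.subtype '' absConvexHull ℝ (Set.range pU) := by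
    rw [image_absConvexHull, ← Set.range_comp]
    rfl
  have : (0 : ℝ) < m := Nat.cast_pos.2 hm
  rw [himage, EReal.coe_add]
  calc entropy (U.subtype '' absConvexHull ℝ (Set.range pU)) (δ / √m / 2 ^ s)
      ≤ entropy (absConvexHull ℝ (Set.range pU)) (δ / √m / 2 ^ s) :=
        entropy_image_le U.subtypeₗᵢ.lipschitz _ _
    _ ≤ entropy (absConvexHull ℝ (Set.range pU)) (δ / √m) +
          (s * Module.finrank ℝ U * Real.log 5 : ℝ) :=
        entropy_div_two_pow_le _ (by positivity) s
    _ ≤ _ := add_le_add_left (entropy_absConvexHull_range_le (p := pU) hp hδ.le hm) _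

end Maurey

section Increments

variable {H : Type*} [NormedAddCommGroup H] [InnerProductSpace ℝ H]

/-- The increments `P₀ f, P₁ f - P₀ f, P₂ f - P₁ f, …` of the orthogonal projections `P_k f` of `f`
onto a sequence of subspaces. -/
noncomputable def projIncrement (𝒱 : ℕ → Submodule ℝ H)
    [∀ k, (𝒱 k).HasOrthogonalProjection] (f : H) : ℕ → H
  | 0 => (𝒱 0).starProjection f
  | k + 1 => (𝒱 (k + 1)).starProjection f - (𝒱 k).starProjection f

variable {𝒱 : ℕ → Submodule ℝ H} [∀ k, (𝒱 k).HasOrthogonalProjection]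

theorem sum_range_succ_projIncrement (f : H) (n : ℕ) :
    ∑ k ∈ Finset.range (n + 1), projIncrement 𝒱 f k = (𝒱 n).starProjection f := by
  induction n with
  | zero => simp [projIncrement]
  | succ n ih => rw [Finset.sum_range_succ, ih, projIncrement, add_sub_cancel]

theorem projIncrement_mem (h𝒱 : Monotone 𝒱) (f : H) (k : ℕ) : projIncrement 𝒱 f k ∈ 𝒱 k := by
  cases k with
  | zero => exact Submodule.starProjection_apply_mem _ f
  | succ k =>
    exact sub_mem (Submodule.starProjection_apply_mem _ f)
      (h𝒱 k.le_succ (Submodule.starProjection_apply_mem _ f))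

theorem projIncrement_succ_mem_orthogonal (h𝒱 : Monotone 𝒱) (f : H) (k : ℕ) :
    projIncrement 𝒱 f (k + 1) ∈ (𝒱 k)ᗮ := by
  have h := sub_mem (Submodule.sub_starProjection_mem_orthogonal (K := 𝒱 k) f)
    (Submodule.orthogonal_le (h𝒱 k.le_succ) (Submodule.sub_starProjection_mem_orthogonal f))
  rwa [sub_sub_sub_cancel_left] at h

theorem inner_projIncrement_eq_zero (h𝒱 : Monotone 𝒱) (f : H) {k l : ℕ} (hkl : k ≠ l) :
    inner ℝ (projIncrement 𝒱 f k) (projIncrement 𝒱 f l) = 0 := by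
  wlog hlt : k < l generalizing k l
  · rw [real_inner_comm]
    exact this hkl.symm (by omega)
  obtain ⟨m, rfl⟩ : ∃ m, l = m + 1 := ⟨l - 1, by omega⟩
  exact Submodule.inner_right_of_mem_orthogonal
    (h𝒱 (Nat.lt_succ_iff.1 hlt) (projIncrement_mem h𝒱 f k))
    (projIncrement_succ_mem_orthogonal h𝒱 f m)

theorem norm_sub_starProjection_le (U : Submodule ℝ H) [U.HasOrthogonalProjection] (f : H) {g : H}
    (hg : g ∈ U) : ‖f - U.starProjection f‖ ≤ ‖f - g‖ := by
  rw [Submodule.starProjection_minimal]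
  exact ciInf_le ⟨0, Set.forall_mem_range.2 fun _ => norm_nonneg _⟩ (⟨g, hg⟩ : U)

theorem norm_projIncrement_succ_le (h𝒱 : Monotone 𝒱) (f : H) (k : ℕ) :
    ‖projIncrement 𝒱 f (k + 1)‖ ≤ ‖f - (𝒱 k).starProjection f‖ := by
  have hproj : projIncrement 𝒱 f (k + 1) =
      (𝒱 (k + 1)).starProjection (f - (𝒱 k).starProjection f) := by
    rw [map_sub, Submodule.starProjection_eq_self_iff.2
      (h𝒱 k.le_succ (Submodule.starProjection_apply_mem _ f)), projIncrement]
  rw [hproj]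
  exact Submodule.norm_starProjection_apply_le _ _

theorem norm_projIncrement_le (h𝒱 : Monotone 𝒱) {f : H} {A ρ : ℝ} (hρ : 0 < ρ) (hρ1 : ρ ≤ 1)
    (hf : ‖f‖ ≤ A) (happrox : ∀ k, ∃ g ∈ 𝒱 k, ‖f - g‖ ≤ A * ρ ^ k) (k : ℕ) :
    ‖projIncrement 𝒱 f k‖ ≤ A / ρ * ρ ^ k := by
  have hA : 0 ≤ A := (norm_nonneg f).trans hf
  cases k with
  | zero =>
    rw [pow_zero, mul_one]
    exact ((Submodule.norm_starProjection_apply_le _ f).trans hf).trans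
      (le_div_self hA hρ hρ1)
  | succ k =>
    obtain ⟨g, hg, hfg⟩ := happrox k
    calc ‖projIncrement 𝒱 f (k + 1)‖ ≤ ‖f - (𝒱 k).starProjection f‖ :=
          norm_projIncrement_succ_le h𝒱 f k
      _ ≤ A * ρ ^ k := (norm_sub_starProjection_le _ f hg).trans hfg
      _ = A / ρ * ρ ^ (k + 1) := by rw [pow_succ]; field_simp

end Increments

section HyperbolicLevels

/-- The multi-indices in the box `[0, n)^d` whose entries sum to `j`. -/
def levelSet (d n j : ℕ) : Finset (Fin d → ℕ) :=
  {k ∈ Fintype.piFinset fun _ => Finset.range n | ∑ i, k i = j}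

theorem sum_eq_of_mem_levelSet {d n j : ℕ} {k : Fin d → ℕ} (hk : k ∈ levelSet d n j) :
    ∑ i, k i = j :=
  (Finset.mem_filter.1 hk).2

theorem card_levelSet_le (d n j : ℕ) : (levelSet d n j).card ≤ (j + 1) ^ (d - 1) := by
  cases d with
  | zero => simpa using Finset.card_le_univ (levelSet 0 n j)
  | succ d =>
    have hcard : (Fintype.piFinset fun _ : Fin d => Finset.range (j + 1)).card = (j + 1) ^ d := by
      simp
    rw [Nat.add_sub_cancel, ← hcard]
    refine Finset.card_le_card_of_injOn Fin.tail (fun k hk => ?_) fun k hk l hl hkl => ?_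
    · simp only [Finset.mem_coe, Fintype.mem_piFinset, Finset.mem_range, Nat.lt_succ_iff]
      exact fun i => (Finset.single_le_sum_of_canonicallyOrdered (Finset.mem_univ i.succ)).trans
        (sum_eq_of_mem_levelSet hk).le
    · have hsum := (sum_eq_of_mem_levelSet hk).trans (sum_eq_of_mem_levelSet hl).symm
      have htail (i : Fin d) : k i.succ = l i.succ := congrFun hkl i
      simp only [Fin.sum_univ_succ, htail, add_left_inj] at hsum
      exact funext (Fin.cases hsum htail)

section Module

variable {R M N : Type*} [CommSemiring R] [AddCommMonoid M] [Module R M] [AddCommMonoid N]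
  [Module R N] {d : ℕ}

/-- The part `∑_{k₁ + ⋯ + k_d = j} x₁(k₁) ⊗ ⋯ ⊗ x_d(k_d)` of total degree `j` in the expansion of
`(∑_{k < n} x₁(k)) ⊗ ⋯ ⊗ (∑_{k < n} x_d(k))`. -/
def levelSum (T : MultilinearMap R (fun _ : Fin d => M) N) (x : Fin d → ℕ → M) (n j : ℕ) : N :=
  ∑ k ∈ levelSet d n j, T fun i => x i (k i)

theorem map_sum_range_eq_sum_levelSum (T : MultilinearMap R (fun _ : Fin d => M) N)
    (x : Fin d → ℕ → M) {n m : ℕ} (hm : d * n < m) :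
    T (fun i => ∑ k ∈ Finset.range n, x i k) = ∑ j ∈ Finset.range m, levelSum T x n j := by
  simp only [levelSum, levelSet]
  rw [T.map_sum_finset, Finset.sum_fiberwise_of_maps_to]
  intro k hk
  have hkn (i : Fin d) : k i ≤ n := (Finset.mem_range.1 (Fintype.mem_piFinset.1 hk i)).le
  have hsum : ∑ i, k i ≤ ∑ _i : Fin d, n := Finset.sum_le_sum fun i _ => hkn i
  simp only [Finset.sum_const, Finset.card_univ, Fintype.card_fin, smul_eq_mul] at hsum
  exact Finset.mem_range.2 (hsum.trans_lt hm)

end Module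

variable {H E : Type*} [NormedAddCommGroup H] [InnerProductSpace ℝ H] [NormedAddCommGroup E]
  [InnerProductSpace ℝ E] {d : ℕ}

/-- A multilinear map behaves like the Hilbert space tensor product if inner products of its values
are products of inner products. -/
def IsTensorMap (T : MultilinearMap ℝ (fun _ : Fin d => H) E) : Prop :=
  ∀ f g, inner ℝ (T f) (T g) = ∏ i, inner ℝ (f i) (g i)

variable {T : MultilinearMap ℝ (fun _ : Fin d => H) E}

theorem IsTensorMap.norm_map (hT : IsTensorMap T) (f : Fin d → H) :
    ‖T f‖ = ∏ i, ‖f i‖ := by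
  have hsq : ‖T f‖ ^ 2 = (∏ i, ‖f i‖) ^ 2 := by
    rw [← real_inner_self_eq_norm_sq, hT, ← Finset.prod_pow]
    exact Finset.prod_congr rfl fun i _ => real_inner_self_eq_norm_sq _
  exact (sq_eq_sq₀ (norm_nonneg _) (Finset.prod_nonneg fun _ _ => norm_nonneg _)).1 hsq

theorem IsTensorMap.norm_map_sub_map_le (hT : IsTensorMap T) {f g : Fin d → H} {A η : ℝ}
    (hA : 0 ≤ A) (hη : 0 ≤ η) (hf : ∀ i, ‖f i‖ ≤ A) (hg : ∀ i, ‖g i‖ ≤ A)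
    (hfg : ∀ i, ‖f i - g i‖ ≤ η) : ‖T f - T g‖ ≤ d * A ^ (d - 1) * η := by
  have h := T.norm_image_sub_le_of_bound zero_le_one
    (fun m => (hT.norm_map m).le.trans_eq (one_mul _).symm) f g
  rw [one_mul, Fintype.card_fin] at h
  refine h.trans ?_
  gcongr
  · exact max_le ((pi_norm_le_iff_of_nonneg hA).2 hf) ((pi_norm_le_iff_of_nonneg hA).2 hg)
  · exact (pi_norm_le_iff_of_nonneg hη).2 hfg

theorem IsTensorMap.norm_sum_sq (hT : IsTensorMap T) {x : Fin d → ℕ → H}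
    (hx : ∀ i k l, k ≠ l → inner ℝ (x i k) (x i l) = 0) (S : Finset (Fin d → ℕ)) :
    ‖∑ k ∈ S, T fun i => x i (k i)‖ ^ 2 = ∑ k ∈ S, ‖T fun i => x i (k i)‖ ^ 2 := by
  rw [← real_inner_self_eq_norm_sq, sum_inner]
  refine Finset.sum_congr rfl fun k hk => ?_
  rw [inner_sum, Finset.sum_eq_single_of_mem k hk, real_inner_self_eq_norm_sq]
  intro l _ hlk
  obtain ⟨i, hi⟩ := Function.ne_iff.1 hlk
  rw [hT]
  exact Finset.prod_eq_zero (Finset.mem_univ i) (hx i _ _ hi.symm)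

theorem IsTensorMap.norm_levelSum_le (hT : IsTensorMap T) {x : Fin d → ℕ → H}
    (hx : ∀ i k l, k ≠ l → inner ℝ (x i k) (x i l) = 0) {C ρ : ℝ} (hC : 0 ≤ C) (hρ : 0 ≤ ρ)
    (hxC : ∀ i k, ‖x i k‖ ≤ C * ρ ^ k) (n j : ℕ) :
    ‖levelSum T x n j‖ ≤ √((j + 1) ^ (d - 1)) * (C ^ d * ρ ^ j) := by
  refine abs_le_of_sq_le_sq' ?_ (by positivity) |>.2
  rw [levelSum, hT.norm_sum_sq hx, mul_pow, Real.sq_sqrt (by positivity)]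
  calc ∑ k ∈ levelSet d n j, ‖T fun i => x i (k i)‖ ^ 2
      ≤ ∑ k ∈ levelSet d n j, (C ^ d * ρ ^ j) ^ 2 := by
        gcongr with k hk
        calc ‖T fun i => x i (k i)‖ = ∏ i, ‖x i (k i)‖ := hT.norm_map _
          _ ≤ ∏ i, (C * ρ ^ k i) := Finset.prod_le_prod (fun i _ => norm_nonneg _)
            fun i _ => hxC i _
          _ = C ^ d * ρ ^ j := by
            rw [Finset.prod_mul_distrib, Finset.prod_const, Finset.card_univ, Fintype.card_fin,
              Finset.prod_pow_eq_pow_sum, sum_eq_of_mem_levelSet hk]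
    _ = (levelSet d n j).card * (C ^ d * ρ ^ j) ^ 2 := by rw [Finset.sum_const, nsmul_eq_mul]
    _ ≤ (j + 1) ^ (d - 1) * (C ^ d * ρ ^ j) ^ 2 := by
      gcongr
      exact_mod_cast card_levelSet_le d n j

end HyperbolicLevels

section LevelSubspaces

variable {𝕜 H E : Type*} [Field 𝕜] [AddCommGroup H] [Module 𝕜 H] [AddCommGroup E] [Module 𝕜 E]
  {d : ℕ}

theorem exists_finset_map_mem_span (T : MultilinearMap 𝕜 (fun _ : Fin d => H) E)
    (V : Fin d → Submodule 𝕜 H) [∀ i, FiniteDimensional 𝕜 (V i)] :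
    ∃ F : Finset E, F.card ≤ ∏ i, Module.finrank 𝕜 (V i) ∧
      ∀ x : Fin d → H, (∀ i, x i ∈ V i) → T x ∈ Submodule.span 𝕜 (F : Set E) := by
  classical
  let b (i : Fin d) := Module.finBasis 𝕜 (V i)
  refine ⟨Finset.univ.image fun σ : ∀ i, Fin (Module.finrank 𝕜 (V i)) => T fun i => b i (σ i),
    Finset.card_image_le.trans (by simp), fun x hx => ?_⟩
  have hrepr : x = fun i => ∑ s, (b i).repr ⟨x i, hx i⟩ s • (b i s : H) := funext fun i => by
    have hsum := congrArg Subtype.val ((b i).sum_repr ⟨x i, hx i⟩)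
    rw [Submodule.coe_sum] at hsum
    exact hsum.symm
  rw [hrepr, T.map_sum]
  refine Submodule.sum_mem _ fun σ _ => ?_
  rw [T.map_smul_univ]
  exact Submodule.smul_mem _ _ (Submodule.subset_span (by simp))

theorem exists_submodule_levelSum_mem (T : MultilinearMap 𝕜 (fun _ : Fin d => H) E)
    {𝒱 : ℕ → Submodule 𝕜 H} [∀ k, FiniteDimensional 𝕜 (𝒱 k)] {q : ℕ}
    (hq : ∀ k, Module.finrank 𝕜 (𝒱 k) ≤ q * 2 ^ k) (n j : ℕ) :
    ∃ U : Submodule 𝕜 E, FiniteDimensional 𝕜 U ∧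
      Module.finrank 𝕜 U ≤ q ^ d * (j + 1) ^ (d - 1) * 2 ^ j ∧
      ∀ x : Fin d → ℕ → H, (∀ i k, x i k ∈ 𝒱 k) → levelSum T x n j ∈ U := by
  classical
  choose F hFcard hF using fun k : Fin d → ℕ => exists_finset_map_mem_span T fun i => 𝒱 (k i)
  refine ⟨Submodule.span 𝕜 ((levelSet d n j).biUnion F : Finset E),
    FiniteDimensional.span_finset 𝕜 _, ?_, fun x hx => Submodule.sum_mem _ fun k hk =>
      Submodule.span_mono ?_ (hF k _ fun i => hx i (k i))⟩
  · calc _ ≤ ∑ k ∈ levelSet d n j, (F k).card :=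
          (finrank_span_finset_le_card _).trans Finset.card_biUnion_le
      _ ≤ ∑ k ∈ levelSet d n j, q ^ d * 2 ^ j := by
          refine Finset.sum_le_sum fun k hk => (hFcard k).trans ?_
          calc ∏ i, Module.finrank 𝕜 (𝒱 (k i)) ≤ ∏ i, q * 2 ^ k i :=
                Finset.prod_le_prod' fun i _ => hq (k i)
            _ = q ^ d * 2 ^ j := by
              rw [Finset.prod_mul_distrib, Finset.prod_const, Finset.card_univ, Fintype.card_fin,
                Finset.prod_pow_eq_pow_sum, sum_eq_of_mem_levelSet hk]
      _ = q ^ d * (levelSet d n j).card * 2 ^ j := by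
          rw [Finset.sum_const, smul_eq_mul]
          ring
      _ ≤ q ^ d * (j + 1) ^ (d - 1) * 2 ^ j := by
          gcongr
          exact card_levelSet_le d n j
  · exact_mod_cast Finset.subset_biUnion_of_mem F hk

end LevelSubspaces

section Chaining

theorem absConvexHull_range_add_subset {A E : Type*} [AddCommGroup E] [Module ℝ E] (x y : A → E) :
    absConvexHull ℝ (Set.range fun a => x a + y a) ⊆
      absConvexHull ℝ (Set.range x) + absConvexHull ℝ (Set.range y) := by
  refine (absConvexHull_mono ?_).trans (absConvexHull_add_subset ℝ)
  rintro _ ⟨a, rfl⟩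
  exact Set.add_mem_add ⟨a, rfl⟩ ⟨a, rfl⟩

theorem absConvexHull_range_sum_subset {A E ι : Type*} [AddCommGroup E] [Module ℝ E]
    (s : Finset ι) (x : ι → A → E) :
    absConvexHull ℝ (Set.range fun a => ∑ j ∈ s, x j a) ⊆
      ∑ j ∈ s, absConvexHull ℝ (Set.range (x j)) := by
  classical
  induction s using Finset.induction_on with
  | empty =>
    simp only [Finset.sum_empty]
    exact absConvexHull_min (Set.range_subset_iff.2 fun _ => rfl)
      ⟨balanced_zero, convex_singleton 0⟩
  | insert i s hi ih =>
    simp only [Finset.sum_insert hi]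
    exact (absConvexHull_range_add_subset _ _).trans (Set.add_subset_add_left ih)

theorem absConvexHull_range_subset_add_closedBall {A B E : Type*} [SeminormedAddCommGroup E]
    [NormedSpace ℝ E] {x : B → E} {y : A → E} {η : ℝ} (h : ∀ b, ∃ a, ‖x b - y a‖ ≤ η) :
    absConvexHull ℝ (Set.range x) ⊆ absConvexHull ℝ (Set.range y) + Metric.closedBall 0 η := by
  refine absConvexHull_min ?_ ⟨(balanced_absConvexHull (𝕜 := ℝ)).add balanced_closedBall_zero,
    convex_absConvexHull.add (convex_closedBall 0 η)⟩
  rintro _ ⟨b, rfl⟩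
  obtain ⟨a, ha⟩ := h b
  exact ⟨y a, subset_absConvexHull ⟨a, rfl⟩, x b - y a, by simpa using ha,
    add_sub_cancel (y a) (x b)⟩

theorem exists_nat_mul_mem_Icc {x : ℝ} (hx : 0 < x) {K : ℕ} (hK : 0 < K) :
    ∃ m : ℕ, 0 < m ∧ x ≤ m * K ∧ (m * K : ℝ) ≤ x + K := by
  have hK' : (0 : ℝ) < K := Nat.cast_pos.2 hK
  refine ⟨⌈x / K⌉₊, Nat.ceil_pos.2 (by positivity), (div_le_iff₀ hK').1 (Nat.le_ceil _), ?_⟩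
  calc (⌈x / K⌉₊ * K : ℝ) ≤ (x / K + 1) * K := by
        gcongr
        exact (Nat.ceil_lt_add_one (by positivity)).le
    _ = x + K := by field_simp

theorem mul_sqrt_mul_pow_div_sqrt_le {G τ : ℝ} (hG : 0 ≤ G) (hτ : 0 ≤ τ) {M m K j : ℕ}
    (hm : 0 < m) (h : (2 ^ j * M : ℝ) ≤ m * K) :
    G * √M * (√2 * τ) ^ j / √m ≤ G * √K * τ ^ j := by
  have hsqrt : √M * √2 ^ j ≤ √K * √m := by
    refine (sq_le_sq₀ (by positivity) (by positivity)).1 ?_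
    rw [mul_pow, mul_pow, pow_right_comm, Real.sq_sqrt zero_le_two]
    simp only [Real.sq_sqrt (Nat.cast_nonneg _)]
    linarith
  rw [div_le_iff₀ (by positivity), mul_pow]
  calc G * √M * (√2 ^ j * τ ^ j) = G * τ ^ j * (√M * √2 ^ j) := by ring
    _ ≤ G * τ ^ j * (√K * √m) := by gcongr
    _ = G * √K * τ ^ j * √m := by ring

variable {A E : Type*} [Fintype A] [NormedAddCommGroup E] [InnerProductSpace ℝ E]
  {p : A → E} {G τ c : ℝ} {M K : ℕ}

theorem entropy_absConvexHull_last_level_le (hG : 0 ≤ G) (hτ : 0 ≤ τ) (hM : 0 < M) (hK : 0 < K)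
    (hcard : Real.log (2 * Fintype.card A) ≤ c * K) (hc : 0 ≤ c)
    (hp : ∀ i, ‖p i‖ ≤ G * √M * (√2 * τ) ^ K) :
    entropy (absConvexHull ℝ (Set.range p)) (G * √K * τ ^ K) ≤
      (c * (2 ^ K * M + K) : ℝ) := by
  obtain ⟨m, hm, hmK, hKm⟩ := exists_nat_mul_mem_Icc (x := 2 ^ K * M) (by positivity) hK
  refine (entropy_anti _ (mul_sqrt_mul_pow_div_sqrt_le hG hτ hm hmK)).trans
    ((entropy_absConvexHull_range_le hp (by positivity) hm).trans (EReal.coe_le_coe ?_))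
  calc m * Real.log (2 * Fintype.card A) ≤ m * (c * K) := by gcongr
    _ = c * (m * K) := by ring
    _ ≤ c * (2 ^ K * M + K) := by gcongr

theorem entropy_absConvexHull_level_le {U : Submodule ℝ E} [FiniteDimensional ℝ U] {a D j : ℕ}
    (hG : 0 < G) (hτ : 0 < τ) (ha : (1 / 2 : ℝ) ^ a ≤ τ / 2) (hM : 0 < M) (hK : 0 < K)
    (hcard : Real.log (2 * Fintype.card A) ≤ c * K) (hc : 0 ≤ c)
    (hp : ∀ i, ‖p i‖ ≤ G * √M * (√2 * τ) ^ j) (hU : ∀ i, p i ∈ U)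
    (hfinrank : Module.finrank ℝ U ≤ D * M * 2 ^ j) (hj : j ≤ K) :
    entropy (absConvexHull ℝ (Set.range p)) (G * √K * τ ^ K * (1 / 2) ^ (K - j)) ≤
      (c * (2 ^ j * M + K) + a * D * Real.log 5 * M * (2 ^ j * (K - j : ℕ)) : ℝ) := by
  obtain ⟨m, hm, hmK, hKm⟩ := exists_nat_mul_mem_Icc (x := 2 ^ j * M) (by positivity) hK
  have hradius : G * √M * (√2 * τ) ^ j / √m / 2 ^ (a * (K - j)) ≤
      G * √K * τ ^ K * (1 / 2) ^ (K - j) :=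
    calc G * √M * (√2 * τ) ^ j / √m / 2 ^ (a * (K - j))
        = G * √M * (√2 * τ) ^ j / √m * ((1 / 2) ^ a) ^ (K - j) := by
          rw [← pow_mul, one_div, inv_pow, div_eq_mul_inv]
      _ ≤ G * √K * τ ^ j * (τ / 2) ^ (K - j) := by
          gcongr
          exact mul_sqrt_mul_pow_div_sqrt_le hG.le hτ.le hm hmK
      _ = G * √K * τ ^ K * (1 / 2) ^ (K - j) := by
          rw [← Nat.add_sub_of_le hj, Nat.add_sub_cancel_left, div_eq_mul_one_div, mul_pow, pow_add]
          ring
  refine (entropy_anti _ hradius).trans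
    ((entropy_absConvexHull_range_le_of_mem U hU hp (by positivity) hm _).trans
      (EReal.coe_le_coe (add_le_add ?_ ?_)))
  · calc m * Real.log (2 * Fintype.card A) ≤ m * (c * K) := by gcongr
      _ = c * (m * K) := by ring
      _ ≤ c * (2 ^ j * M + K) := by gcongr
  · calc ((a * (K - j) : ℕ) * Module.finrank ℝ U * Real.log 5 : ℝ)
        ≤ (a * (K - j) : ℕ) * (D * M * 2 ^ j : ℕ) * Real.log 5 := by gcongr
      _ = a * D * Real.log 5 * M * (2 ^ j * (K - j : ℕ)) := by push_cast; ring

theorem sum_half_pow_sub_le_one (K : ℕ) : ∑ j ∈ Finset.range K, (1 / 2 : ℝ) ^ (K - j) ≤ 1 := by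
  induction K with
  | zero => simp
  | succ K ih =>
    have hstep (j : ℕ) (hj : j ∈ Finset.range K) :
        (1 / 2 : ℝ) ^ (K + 1 - j) = 1 / 2 * (1 / 2) ^ (K - j) := by
      rw [Nat.succ_sub (Finset.mem_range.1 hj).le, pow_succ']
    rw [Finset.sum_range_succ, Finset.sum_congr rfl hstep, ← Finset.mul_sum,
      Nat.add_sub_cancel_left]
    linarith

theorem sum_two_pow_mul_sub_le (K : ℕ) :
    ∑ j ∈ Finset.range K, 2 ^ j * (K - j) ≤ 2 * 2 ^ K := by
  have hsum : ∑ j ∈ Finset.range K, 2 ^ j * (K - j) + K + 2 = 2 * 2 ^ K := by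
    induction K with
    | zero => simp
    | succ K ih =>
      have hstep (j : ℕ) (hj : j ∈ Finset.range K) :
          2 ^ j * (K + 1 - j) = 2 ^ j * (K - j) + 2 ^ j := by
        rw [Nat.succ_sub (Finset.mem_range.1 hj).le, Nat.mul_succ]
      have hgeom := Nat.geomSum_eq le_rfl K
      have hpow := Nat.one_le_two_pow (n := K)
      rw [Finset.sum_range_succ, Finset.sum_congr rfl hstep, Finset.sum_add_distrib, hgeom,
        Nat.add_sub_cancel_left]
      omega
  omega

theorem mul_succ_le_two_mul_two_pow (K : ℕ) : K * (K + 1) ≤ 2 * 2 ^ K := by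
  induction K with
  | zero => simp
  | succ K ih =>
    have hK := K.lt_two_pow_self
    rw [pow_succ]
    nlinarith

theorem sum_level_bounds_le {c D : ℝ} (hc : 0 ≤ c) (hD : 0 ≤ D) {M : ℕ} (hM : 0 < M) (K : ℕ) :
    ∑ j ∈ Finset.range K, (c * (2 ^ j * M + K) + D * M * (2 ^ j * (K - j : ℕ))) +
      c * (2 ^ K * M + K) ≤ (4 * c + 2 * D) * (2 ^ K * M) := by
  have hM' : (1 : ℝ) ≤ M := by exact_mod_cast hM
  have hgeom : ∑ j ∈ Finset.range K, (2 : ℝ) ^ j = 2 ^ K - 1 := by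
    rw [geom_sum_eq (by norm_num)]
    norm_num
  have hsum : ∑ j ∈ Finset.range K, (2 ^ j * (K - j : ℕ) : ℝ) ≤ 2 * 2 ^ K := by
    exact_mod_cast sum_two_pow_mul_sub_le K
  have hsq : (K * (K + 1) : ℝ) ≤ 2 * 2 ^ K * M :=
    (by exact_mod_cast mul_succ_le_two_mul_two_pow K : (K * (K + 1) : ℝ) ≤ 2 * 2 ^ K).trans
      (le_mul_of_one_le_right (by positivity) hM')
  calc _ = c * ((2 ^ K - 1) * M + 2 ^ K * M + K * (K + 1)) +
        D * M * ∑ j ∈ Finset.range K, (2 ^ j * (K - j : ℕ) : ℝ) := by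
        rw [Finset.sum_add_distrib, ← Finset.mul_sum, ← Finset.mul_sum, Finset.sum_add_distrib,
          ← Finset.sum_mul, hgeom, Finset.sum_const, Finset.card_range, nsmul_eq_mul]
        ring
    _ ≤ c * (2 ^ K * M + 2 ^ K * M + 2 * 2 ^ K * M) + D * M * (2 * 2 ^ K) := by
        gcongr
        linarith
    _ = (4 * c + 2 * D) * (2 ^ K * M) := by ring

theorem entropy_absConvexHull_sum_levels_le {r : ℕ → A → E} {t : A → E} {a D : ℕ}
    (hG : 0 < G) (hτ : 0 < τ) (ha : (1 / 2 : ℝ) ^ a ≤ τ / 2) (hM : 0 < M) (hK : 0 < K)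
    (hcard : Real.log (2 * Fintype.card A) ≤ c * K) (hc : 0 ≤ c)
    (hr : ∀ j < K, ∀ i, ‖r j i‖ ≤ G * √M * (√2 * τ) ^ j)
    (hrU : ∀ j < K, ∃ U : Submodule ℝ E, FiniteDimensional ℝ U ∧
      Module.finrank ℝ U ≤ D * M * 2 ^ j ∧ ∀ i, r j i ∈ U)
    (ht : ∀ i, ‖t i‖ ≤ G * √M * (√2 * τ) ^ K) :
    entropy (absConvexHull ℝ (Set.range fun i => ∑ j ∈ Finset.range K, r j i + t i))
      (2 * (G * √K * τ ^ K)) ≤ ((4 * c + 2 * (a * D * Real.log 5)) * (2 ^ K * M) : ℝ) := by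
  set R := G * √K * τ ^ K
  let ε (j : ℕ) : ℝ := R * (1 / 2) ^ (K - j)
  let B (j : ℕ) : ℝ := c * (2 ^ j * M + K) + a * D * Real.log 5 * M * (2 ^ j * (K - j : ℕ))
  have hR : 0 ≤ R := by positivity
  have hlevels : entropy (∑ j ∈ Finset.range K, absConvexHull ℝ (Set.range (r j)))
      (∑ j ∈ Finset.range K, ε j) ≤ (∑ j ∈ Finset.range K, B j : ℝ) := by
    refine entropy_sum_le _ _ (fun _ _ => by positivity) fun j hj => ?_
    have hjK := Finset.mem_range.1 hj
    obtain ⟨U, _, hfinrank, hU⟩ := hrU j hjK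
    exact entropy_absConvexHull_level_le hG hτ ha hM hK hcard hc (hr j hjK) hU hfinrank hjK.le
  have htail := entropy_absConvexHull_last_level_le hG.le hτ.le hM hK hcard hc ht
  have hradius : ∑ j ∈ Finset.range K, ε j + R ≤ 2 * R := by
    have h := mul_le_mul_of_nonneg_left (sum_half_pow_sub_le_one K) hR
    rw [Finset.mul_sum] at h
    linarith
  calc entropy (absConvexHull ℝ (Set.range fun i => ∑ j ∈ Finset.range K, r j i + t i)) (2 * R)
      ≤ entropy (∑ j ∈ Finset.range K, absConvexHull ℝ (Set.range (r j)) +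
          absConvexHull ℝ (Set.range t)) (∑ j ∈ Finset.range K, ε j + R) :=
        (entropy_anti _ hradius).trans <| entropy_mono_set
          ((absConvexHull_range_add_subset _ _).trans
            (Set.add_subset_add_right (absConvexHull_range_sum_subset _ _))) _
    _ ≤ (∑ j ∈ Finset.range K, B j : ℝ) + (c * (2 ^ K * M + K) : ℝ) :=
        (entropy_add_le _ _ (Finset.sum_nonneg fun _ _ => by positivity) hR).trans
          (add_le_add hlevels htail)
    _ ≤ ((4 * c + 2 * (a * D * Real.log 5)) * (2 ^ K * M) : ℝ) := by
        rw [← EReal.coe_add]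
        exact EReal.coe_le_coe (sum_level_bounds_le hc (by positivity) hM K)

end Chaining

section TensorLevels

theorem exists_forall_sum_add_two_pow_mul_le {ρ : ℝ} (hρ : 0 < ρ) (hρ1 : ρ < 1) (e : ℕ) :
    ∃ S : ℝ, 1 ≤ S ∧ ∀ m : ℕ, ∑ i ∈ Finset.range m, ((i : ℝ) + 2) ^ e * ρ ^ i ≤ S := by
  have hgeom : Summable fun i : ℕ => (i : ℝ) ^ e * ρ ^ i :=
    summable_pow_mul_geometric_of_norm_lt_one e (by rwa [Real.norm_of_nonneg hρ.le])
  have hsummable : Summable fun i : ℕ => ((i : ℝ) + 2) ^ e * ρ ^ i := by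
    refine (((summable_nat_add_iff 2).2 hgeom).mul_right (ρ ^ 2)⁻¹).congr fun i => ?_
    push_cast
    rw [pow_add, mul_assoc, mul_inv_cancel_right₀ (pow_ne_zero 2 hρ.ne')]
  exact ⟨_, le_max_left _ _, fun m =>
    (hsummable.sum_le_tsum _ fun i _ => by positivity).trans (le_max_right _ _)⟩

variable {H E : Type*} [NormedAddCommGroup H] [InnerProductSpace ℝ H] [NormedAddCommGroup E]
  [InnerProductSpace ℝ E] {d : ℕ} {T : MultilinearMap ℝ (fun _ : Fin d => H) E}

theorem IsTensorMap.norm_sum_levelSum_add_le (hT : IsTensorMap T) {x : Fin d → ℕ → H}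
    (hx : ∀ i k l, k ≠ l → inner ℝ (x i k) (x i l) = 0) {C ρ : ℝ} (hC : 0 ≤ C) (hρ : 0 ≤ ρ)
    (hxC : ∀ i k, ‖x i k‖ ≤ C * ρ ^ k) (n m : ℕ) {K : ℕ} (hK : 0 < K) :
    ‖∑ i ∈ Finset.range m, levelSum T x n (K + i)‖ ≤
      C ^ d * (∑ i ∈ Finset.range m, ((i : ℝ) + 2) ^ (d - 1) * ρ ^ i) * √(K ^ (d - 1)) *
        ρ ^ K := by
  have hK' : (1 : ℝ) ≤ K := by exact_mod_cast hK
  have hsqrt (i : ℕ) :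
      √(((K + i : ℕ) + 1) ^ (d - 1)) ≤ √(K ^ (d - 1)) * ((i : ℝ) + 2) ^ (d - 1) := by
    rw [Real.sqrt_le_left (by positivity), mul_pow, Real.sq_sqrt (by positivity), ← pow_mul,
      mul_comm (d - 1), pow_mul, ← mul_pow]
    gcongr
    calc (((K + i : ℕ) : ℝ) + 1) ≤ K * (i + 2) := by
          push_cast
          nlinarith [(Nat.cast_nonneg i : (0 : ℝ) ≤ i)]
      _ ≤ K * ((i : ℝ) + 2) ^ 2 := by
          gcongr
          exact le_self_pow₀ (by linarith [(Nat.cast_nonneg i : (0 : ℝ) ≤ i)]) two_ne_zero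
  calc ‖∑ i ∈ Finset.range m, levelSum T x n (K + i)‖
      ≤ ∑ i ∈ Finset.range m, √(((K + i : ℕ) + 1) ^ (d - 1)) * (C ^ d * ρ ^ (K + i)) :=
        norm_sum_le_of_le _ fun i _ => hT.norm_levelSum_le hx hC hρ hxC n _
    _ ≤ ∑ i ∈ Finset.range m,
        √(K ^ (d - 1)) * ((i : ℝ) + 2) ^ (d - 1) * (C ^ d * ρ ^ (K + i)) := by
        gcongr with i
        exact hsqrt i
    _ = _ := by
        rw [Finset.mul_sum, Finset.sum_mul, Finset.sum_mul]
        exact Finset.sum_congr rfl fun i _ => by rw [pow_add]; ring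

theorem IsTensorMap.norm_levelSum_le_of_lt (hT : IsTensorMap T) {x : Fin d → ℕ → H}
    (hx : ∀ i k l, k ≠ l → inner ℝ (x i k) (x i l) = 0) {C ρ : ℝ} (hC : 0 ≤ C) (hρ : 0 ≤ ρ)
    (hxC : ∀ i k, ‖x i k‖ ≤ C * ρ ^ k) (n : ℕ) {j K : ℕ} (hj : j < K) :
    ‖levelSum T x n j‖ ≤ C ^ d * √(K ^ (d - 1)) * ρ ^ j := by
  refine (hT.norm_levelSum_le hx hC hρ hxC n j).trans ?_
  rw [← mul_assoc, mul_comm (√_)]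
  gcongr
  exact_mod_cast hj

variable {𝒱 : ℕ → Submodule ℝ H} [∀ k, FiniteDimensional ℝ (𝒱 k)] {L τ : ℝ} {q : ℕ}

theorem IsTensorMap.entropy_absConvexHull_map_starProjection_le {A : Type*} [Fintype A]
    (hT : IsTensorMap T) (h𝒱 : Monotone 𝒱) (hq : ∀ k, Module.finrank ℝ (𝒱 k) ≤ q * 2 ^ k)
    (hτ : 0 < τ) (hτ1 : √2 * τ ≤ 1) {y : A → Fin d → H} (hL : 0 < L)
    (hy : ∀ i j, ‖y i j‖ ≤ L)
    (happrox : ∀ i j k, ∃ g ∈ 𝒱 k, ‖y i j - g‖ ≤ L * (√2 * τ) ^ k) {S : ℝ} (hS : 1 ≤ S)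
    (hSsum : ∀ m, ∑ i ∈ Finset.range m, ((i : ℝ) + 2) ^ (d - 1) * (√2 * τ) ^ i ≤ S)
    {a : ℕ} (ha : (1 / 2 : ℝ) ^ a ≤ τ / 2) {c : ℝ} (hc : 0 ≤ c) {K : ℕ} (hK : 0 < K)
    (hcard : Real.log (2 * Fintype.card A) ≤ c * K) (N : ℕ) :
    entropy (absConvexHull ℝ (Set.range fun i => T fun j => (𝒱 N).starProjection (y i j)))
      (2 * ((L / (√2 * τ)) ^ d * S * √K * τ ^ K)) ≤
        ((4 * c + 2 * (a * (q ^ d : ℕ) * Real.log 5)) * (2 ^ K * (K ^ (d - 1) : ℕ)) : ℝ) := by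
  set ρ := √2 * τ
  have hρ : 0 < ρ := by positivity
  have hLρ : 0 < L / ρ := by positivity
  let x (i : A) (j : Fin d) := projIncrement 𝒱 (y i j)
  have hxort (i : A) (j : Fin d) (k l : ℕ) (hkl : k ≠ l) : inner ℝ (x i j k) (x i j l) = 0 :=
    inner_projIncrement_eq_zero h𝒱 _ hkl
  have hxnorm (i : A) (j : Fin d) (k : ℕ) : ‖x i j k‖ ≤ L / ρ * ρ ^ k :=
    norm_projIncrement_le h𝒱 hρ hτ1 (hy i j) (happrox i j) k
  have hsplit (i : A) : T (fun j => (𝒱 N).starProjection (y i j)) =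
      ∑ j ∈ Finset.range K, levelSum T (x i) (N + 1) j +
        ∑ j ∈ Finset.range (d * (N + 1) + 1), levelSum T (x i) (N + 1) (K + j) := by
    rw [← Finset.sum_range_add, ← map_sum_range_eq_sum_levelSum T (x i) (by omega)]
    simp only [x, sum_range_succ_projIncrement]
  have hlevel (j : ℕ) (hj : j < K) (i : A) :
      ‖levelSum T (x i) (N + 1) j‖ ≤ (L / ρ) ^ d * S * √(K ^ (d - 1) : ℕ) * ρ ^ j := by
    refine (hT.norm_levelSum_le_of_lt (hxort i) hLρ.le hρ.le (hxnorm i) _ hj).trans ?_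
    rw [Nat.cast_pow]
    gcongr
    exact le_mul_of_one_le_right (by positivity) hS
  have htail (i : A) :
      ‖∑ j ∈ Finset.range (d * (N + 1) + 1), levelSum T (x i) (N + 1) (K + j)‖ ≤
        (L / ρ) ^ d * S * √(K ^ (d - 1) : ℕ) * ρ ^ K := by
    refine (hT.norm_sum_levelSum_add_le (hxort i) hLρ.le hρ.le (hxnorm i) _ _ hK).trans ?_
    rw [Nat.cast_pow]
    gcongr
    exact hSsum _
  have hsubspace (j : ℕ) (hj : j < K) : ∃ U : Submodule ℝ E, FiniteDimensional ℝ U ∧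
      Module.finrank ℝ U ≤ q ^ d * K ^ (d - 1) * 2 ^ j ∧
        ∀ i, levelSum T (x i) (N + 1) j ∈ U := by
    obtain ⟨U, hUfin, hUdim, hU⟩ := exists_submodule_levelSum_mem T hq (N + 1) j
    refine ⟨U, hUfin, hUdim.trans ?_, fun i => hU _ fun j k => projIncrement_mem h𝒱 _ k⟩
    gcongr
    omega
  simp only [hsplit]
  exact entropy_absConvexHull_sum_levels_le (by positivity) hτ ha (by positivity) hK hcard hc
    hlevel hsubspace htail

theorem IsTensorMap.norm_map_sub_map_starProjection_le (hT : IsTensorMap T)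
    (U : Submodule ℝ H) [U.HasOrthogonalProjection] {f g : Fin d → H} {η : ℝ} (hL : 0 ≤ L)
    (hf : ∀ i, ‖f i‖ ≤ L) (hg : ∀ i, ‖g i‖ ≤ L) (hfg : ∀ i, ‖f i - g i‖ ≤ 2 * η)
    (hgU : ∀ i, ∃ h ∈ U, ‖g i - h‖ ≤ L * η) (hη : 0 ≤ η) :
    ‖T f - T fun i => U.starProjection (g i)‖ ≤ d * L ^ (d - 1) * ((2 + L) * η) := by
  refine hT.norm_map_sub_map_le hL (by positivity) hf
    (fun i => (Submodule.norm_starProjection_apply_le _ _).trans (hg i)) fun i => ?_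
  obtain ⟨h, hU, hgh⟩ := hgU i
  calc ‖f i - U.starProjection (g i)‖ ≤ ‖f i - g i‖ + ‖g i - U.starProjection (g i)‖ :=
        norm_sub_le_norm_sub_add_norm_sub _ _ _
    _ ≤ 2 * η + L * η := add_le_add (hfg i) ((norm_sub_starProjection_le U _ hU).trans hgh)
    _ = (2 + L) * η := by ring

theorem IsTensorMap.absConvexHull_range_map_subset_add_closedBall {Θ : Type*} {ψ : Θ → H}
    (hT : IsTensorMap T) (U : Submodule ℝ H) [U.HasOrthogonalProjection] (hL : 0 ≤ L)
    (hψ : ∀ v, ‖ψ v‖ ≤ L) {η : ℝ} (hη : 0 ≤ η) (happrox : ∀ v, ∃ g ∈ U, ‖ψ v - g‖ ≤ L * η)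
    {S : Finset Θ} (hS : ∀ v, ∃ w ∈ S, ‖ψ v - ψ w‖ ≤ 2 * η) :
    absConvexHull ℝ (Set.range fun v : Fin d → Θ => T fun i => ψ (v i)) ⊆
      absConvexHull ℝ (Set.range fun w : Fin d → S => T fun i => U.starProjection (ψ (w i))) +
        Metric.closedBall 0 (d * L ^ (d - 1) * ((2 + L) * η)) := by
  refine absConvexHull_range_subset_add_closedBall fun v => ?_
  choose w hwS hw using fun i => hS (v i)
  exact ⟨fun i => ⟨w i, hwS i⟩, hT.norm_map_sub_map_starProjection_le U hL (fun _ => hψ _)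
    (fun _ => hψ _) hw (fun _ => happrox _) hη⟩

theorem log_two_mul_pow_le {s c : ℝ} (hs : 0 < s) {K : ℕ} (hK : 0 < K)
    (hsc : s ≤ Real.exp (c * K)) (d : ℕ) :
    Real.log (2 * s ^ d) ≤ (Real.log 2 + d * c) * K := by
  have hK' : (1 : ℝ) ≤ K := by exact_mod_cast hK
  have hlog : Real.log s ≤ c * K := (Real.log_le_iff_le_exp hs).2 hsc
  rw [Real.log_mul two_ne_zero (by positivity), Real.log_pow, add_mul, mul_assoc]
  gcongr
  exact le_mul_of_one_le_right (Real.log_nonneg one_le_two) hK'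

theorem IsTensorMap.exists_entropy_closedAbsConvexHull_le {Θ : Type*} [Nonempty Θ] {ψ : Θ → H}
    (hT : IsTensorMap T) (h𝒱 : Monotone 𝒱) (hq : ∀ k, Module.finrank ℝ (𝒱 k) ≤ q * 2 ^ k)
    (hτ : 0 < τ) (hτ1 : √2 * τ < 1) (hL : 0 < L) (hψ : ∀ v, ‖ψ v‖ ≤ L)
    (happrox : ∀ v k, ∃ g ∈ 𝒱 k, ‖ψ v - g‖ ≤ L * (√2 * τ) ^ k) {c : ℝ} (hc : 0 ≤ c) :
    ∃ G B : ℝ, 0 < G ∧ 0 < B ∧ ∀ K : ℕ, 0 < K →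
      (∃ S : Finset Θ, (S.card : ℝ) ≤ Real.exp (c * K) ∧
        ∀ v, ∃ w ∈ S, ‖ψ v - ψ w‖ ≤ 2 * τ ^ K) →
      entropy (closedAbsConvexHull ℝ (Set.range fun v : Fin d → Θ => T fun i => ψ (v i)))
        (G * √K * τ ^ K) ≤ (B * (2 ^ K * K ^ (d - 1)) : ℝ) := by
  obtain ⟨a, ha⟩ := exists_pow_lt_of_lt_one (half_pos hτ) (one_half_lt_one (α := ℝ))
  obtain ⟨Q, hQ, hQsum⟩ := exists_forall_sum_add_two_pow_mul_le (by positivity) hτ1 (d - 1)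
  set G := (L / (√2 * τ)) ^ d * Q
  set η := d * L ^ (d - 1) * (2 + L) with hη
  refine ⟨2 * G + η, 4 * (Real.log 2 + d * c) + 2 * (a * (q ^ d : ℕ) * Real.log 5),
    by positivity, by positivity, fun K hK ⟨S, hScard, hS⟩ => ?_⟩
  obtain ⟨N, hN⟩ := exists_pow_lt_of_lt_one (pow_pos hτ K) hτ1
  have hnet := hT.absConvexHull_range_map_subset_add_closedBall (𝒱 N) hL.le hψ (pow_pos hτ K).le
    (fun v => (happrox v N).imp fun _ hg => ⟨hg.1, hg.2.trans (by gcongr)⟩) hS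
  rw [← mul_assoc, ← hη] at hnet
  have hcard : Real.log (2 * Fintype.card (Fin d → S)) ≤ (Real.log 2 + d * c) * K := by
    obtain ⟨w, hw, -⟩ := hS (Classical.arbitrary Θ)
    rw [Fintype.card_fun, Fintype.card_coe, Fintype.card_fin, Nat.cast_pow]
    exact log_two_mul_pow_le (Nat.cast_pos.2 (Finset.card_pos.2 ⟨w, hw⟩)) hK hScard d
  have hK' : (1 : ℝ) ≤ √K := Real.one_le_sqrt.2 (by exact_mod_cast hK)
  have hradius : 2 * (G * √K * τ ^ K) + η * τ ^ K ≤ (2 * G + η) * √K * τ ^ K := by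
    have h := mul_le_mul_of_nonneg_left hK' (by positivity : 0 ≤ η * τ ^ K)
    linarith
  rw [closedAbsConvexHull_eq_closure_absConvexHull]
  refine ((entropy_closure_le _ _).trans ((entropy_anti _ hradius).trans
    ((entropy_mono_set hnet _).trans
      (entropy_add_closedBall_le _ (by positivity) (by positivity))))).trans ?_
  exact_mod_cast hT.entropy_absConvexHull_map_starProjection_le h𝒱 hq hτ hτ1.le hL
    (fun _ _ => hψ _) (fun _ _ => happrox _) hQ hQsum ha.le (by positivity) hK hcard N

end TensorLevels

section Asymptotics

theorem LesssimZero.exists_eventually_le {h : ℝ → EReal} {g : ℝ → ℝ} (hhg : LesssimZero h g)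
    (hg : ∀ᶠ ε in 𝓝[>] (0 : ℝ), 0 < g ε) :
    ∃ C : ℝ, ∀ᶠ ε in 𝓝[>] (0 : ℝ), h ε ≤ (C * g ε : ℝ) := by
  obtain ⟨C, hC, -⟩ := EReal.lt_iff_exists_real_btwn.1 hhg
  refine ⟨C, ?_⟩
  filter_upwards [hg, eventually_lt_of_limsup_lt hC] with ε hgε hlt
  rw [mul_comm, EReal.coe_mul]
  exact (EReal.div_le_iff_le_mul (EReal.coe_pos.2 hgε) (EReal.coe_ne_top _)).1 hlt.le

theorem lesssimZero_of_eventually_le {h : ℝ → EReal} {g : ℝ → ℝ} {C : ℝ}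
    (hg : ∀ᶠ ε in 𝓝[>] (0 : ℝ), 0 < g ε) (hC : ∀ᶠ ε in 𝓝[>] (0 : ℝ), h ε ≤ (C * g ε : ℝ)) :
    LesssimZero h g := by
  refine (limsup_le_of_le (a := (C : EReal)) isCobounded_le_of_bot ?_).trans_lt (EReal.coe_lt_top C)
  filter_upwards [hg, hC] with ε hgε hle
  rwa [EReal.div_le_iff_le_mul (EReal.coe_pos.2 hgε) (EReal.coe_ne_top _), ← EReal.coe_mul,
    mul_comm]

theorem LesssimZero.mono_left {h h' : ℝ → EReal} {g : ℝ → ℝ} (hle : ∀ ε, h ε ≤ h' ε)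
    (hg : ∀ᶠ ε in 𝓝[>] (0 : ℝ), 0 ≤ g ε) (hh' : LesssimZero h' g) : LesssimZero h g :=
  (limsup_le_limsup <| hg.mono fun ε hgε =>
    EReal.div_le_div_right_of_nonneg (EReal.coe_nonneg.2 hgε) (hle ε)).trans_lt hh'

theorem tendsto_log_one_div_nhdsGT_zero :
    Tendsto (fun ε : ℝ => Real.log (1 / ε)) (𝓝[>] 0) atTop := by
  simp only [one_div, Real.log_inv]
  exact tendsto_neg_atBot_atTop.comp Real.tendsto_log_nhdsGT_zero

theorem exists_two_pow_mem_Icc {y : ℝ} (hy : 1 ≤ y) : ∃ K : ℕ, y ≤ 2 ^ K ∧ 2 ^ K ≤ 2 * y := by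
  obtain ⟨n, hn, hn'⟩ := exists_nat_pow_near hy one_lt_two
  exact ⟨n + 1, hn'.le, by rw [pow_succ']; gcongr⟩

theorem mul_sqrt_mul_two_rpow_pow_le {G t p ε : ℝ} {K : ℕ} (hG : 0 ≤ G) (hp : 0 < p) (hε : 0 < ε)
    (hKt : K ≤ t) (hK : (G * √t / ε) ^ p ≤ 2 ^ K) : G * √K * ((2 : ℝ) ^ (-p⁻¹)) ^ K ≤ ε := by
  have hscale : G * √t / ε ≤ ((2 : ℝ) ^ p⁻¹) ^ K := by
    rw [← Real.rpow_mul_natCast zero_le_two, mul_comm p⁻¹, Real.rpow_mul zero_le_two,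
      Real.rpow_natCast]
    exact (Real.le_rpow_inv_iff_of_pos (by positivity) (by positivity) hp).2 hK
  rw [Real.rpow_neg zero_le_two, inv_pow, ← div_eq_mul_inv, div_le_iff₀ (by positivity)]
  calc G * √K ≤ G * √t := by gcongr
    _ ≤ ε * ((2 : ℝ) ^ p⁻¹) ^ K := by
      rwa [div_le_iff₀' hε] at hscale

theorem eventually_log_two_mul_rpow_le {b p : ℝ} (hb : 0 < b) (hp : 0 < p) :
    ∀ᶠ ε in 𝓝[>] (0 : ℝ),
      Real.log (2 * (b * √(Real.log (1 / ε)) / ε) ^ p) ≤ (3 / 2 * p + 1) * Real.log (1 / ε) := by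
  filter_upwards [self_mem_nhdsWithin, tendsto_log_one_div_nhdsGT_zero.eventually_ge_atTop 1,
    tendsto_log_one_div_nhdsGT_zero.eventually_ge_atTop (Real.log 2 + p * Real.log b)]
    with ε (hε : 0 < ε) hL hLb
  set L := Real.log (1 / ε) with hL_def
  have hL0 : 0 < L := one_pos.trans_le hL
  have hlogε : Real.log ε = -L := by rw [hL_def, one_div, Real.log_inv, neg_neg]
  have hlogL : Real.log L ≤ L := (Real.log_le_sub_one_of_pos hL0).trans (sub_le_self L zero_le_one)
  rw [Real.log_mul two_ne_zero (by positivity), Real.log_rpow (by positivity),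
    Real.log_div (by positivity) hε.ne', Real.log_mul hb.ne' (by positivity),
    Real.log_sqrt hL0.le, hlogε]
  nlinarith [mul_le_mul_of_nonneg_left hlogL hp.le]

theorem mul_sqrt_div_rpow_eq {b L p ε : ℝ} (hb : 0 ≤ b) (hL : 0 ≤ L) (hε : 0 < ε) :
    (b * √L / ε) ^ p = b ^ p * (ε ^ (-p) * L ^ (p / 2)) := by
  rw [Real.div_rpow (by positivity) hε.le, Real.mul_rpow hb (Real.sqrt_nonneg L),
    Real.sqrt_eq_rpow, ← Real.rpow_mul hL, Real.rpow_neg hε.le]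
  ring_nf

theorem tendsto_rpow_neg_mul_log_rpow_atTop {p : ℝ} (hp : 0 < p) :
    Tendsto (fun ε : ℝ => ε ^ (-p) * Real.log (1 / ε) ^ (p / 2)) (𝓝[>] 0) atTop :=
  (tendsto_rpow_neg_nhdsGT_zero (neg_lt_zero.2 hp)).atTop_mul_atTop₀
    ((tendsto_rpow_atTop (half_pos hp)).comp tendsto_log_one_div_nhdsGT_zero)

theorem eventually_exists_scale {G p : ℝ} (hG : 0 < G) (hp : 0 < p) (K₀ : ℕ) :
    ∃ c C : ℝ, 0 < c ∧ 0 < C ∧ ∀ᶠ ε in 𝓝[>] (0 : ℝ), ∃ K : ℕ, K₀ ≤ K ∧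
      G * √K * ((2 : ℝ) ^ (-p⁻¹)) ^ K ≤ ε ∧ K ≤ c * Real.log (1 / ε) ∧
      2 ^ K ≤ C * (ε ^ (-p) * Real.log (1 / ε) ^ (p / 2)) := by
  have hlog2 : 0 < Real.log 2 := Real.log_pos one_lt_two
  set c := (3 / 2 * p + 1) / Real.log 2 with hc_def
  have hc : 0 < c := by positivity
  have hb : 0 < G * √c := by positivity
  refine ⟨c, 2 * (G * √c) ^ p, hc, by positivity, ?_⟩
  filter_upwards [self_mem_nhdsWithin, eventually_log_two_mul_rpow_le hb hp,
    tendsto_log_one_div_nhdsGT_zero.eventually_gt_atTop 0,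
    ((tendsto_rpow_neg_mul_log_rpow_atTop hp).const_mul_atTop
      (Real.rpow_pos_of_pos hb p)).eventually_ge_atTop (2 ^ K₀)]
    with ε (hε : 0 < ε) hlog hL hlarge
  rw [← mul_sqrt_div_rpow_eq hb.le hL.le hε] at hlarge
  obtain ⟨K, hyK, hKy⟩ := exists_two_pow_mem_Icc ((one_le_pow₀ one_le_two).trans hlarge)
  have hKL : (K : ℝ) ≤ c * Real.log (1 / ε) := by
    rw [hc_def, div_mul_eq_mul_div, le_div_iff₀ hlog2, ← Real.log_pow]
    exact (Real.log_le_log (by positivity) hKy).trans hlog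
  refine ⟨K, (pow_le_pow_iff_right₀ one_lt_two).1 (hlarge.trans hyK),
    mul_sqrt_mul_two_rpow_pow_le hG.le hp hε hKL ?_, hKL, ?_⟩
  · rwa [Real.sqrt_mul hc.le, ← mul_assoc]
  · rwa [mul_assoc, ← mul_sqrt_div_rpow_eq hb.le hL.le hε]

theorem lesssimZero_entropy_of_forall_scale {E : Type*} [PseudoMetricSpace E] {F : Set E}
    {p G B : ℝ} (hp : 0 < p) (hG : 0 < G) (hB : 0 ≤ B) (n : ℕ)
    (hF : ∀ᶠ K : ℕ in atTop, entropy F (G * √K * ((2 : ℝ) ^ (-p⁻¹)) ^ K) ≤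
      (B * (2 ^ K * K ^ n) : ℝ)) :
    LesssimZero (entropy F)
      (fun ε => ε ^ (-p) * Real.log (1 / ε) ^ n * Real.log (1 / ε) ^ (p / 2)) := by
  obtain ⟨K₀, hK₀⟩ := eventually_atTop.1 hF
  obtain ⟨c, C, hc, hC, hscale⟩ := eventually_exists_scale hG hp K₀
  have hL := tendsto_log_one_div_nhdsGT_zero.eventually_gt_atTop 0
  refine lesssimZero_of_eventually_le (C := B * (C * c ^ n)) ?_ ?_
  · filter_upwards [self_mem_nhdsWithin, hL] with ε (hε : 0 < ε) hL
    positivity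
  · filter_upwards [self_mem_nhdsWithin, hL, hscale] with ε (hε : 0 < ε) hL ⟨K, hK, hKε, hKL, hK2⟩
    refine (entropy_anti F hKε).trans ((hK₀ K hK).trans (EReal.coe_le_coe ?_))
    calc B * (2 ^ K * K ^ n)
        ≤ B * (C * (ε ^ (-p) * Real.log (1 / ε) ^ (p / 2)) * (c * Real.log (1 / ε)) ^ n) := by
          gcongr
      _ = B * (C * c ^ n) *
          (ε ^ (-p) * Real.log (1 / ε) ^ n * Real.log (1 / ε) ^ (p / 2)) := by
        rw [mul_pow]
        ring

end Asymptotics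

section LogarithmicEntropy

theorem lesssimZero_entropy_of_lesssimZero_coveringNum {E : Type*} [PseudoMetricSpace E]
    {S : Set E} {V : ℝ}
    (h : LesssimZero (fun ε => (coveringNum S ε : EReal)) (fun ε => ε ^ (-V))) :
    LesssimZero (entropy S) (fun ε => Real.log (1 / ε)) := by
  obtain ⟨C, hC⟩ := h.exists_eventually_le <| by
    filter_upwards [self_mem_nhdsWithin] with ε hε using Real.rpow_pos_of_pos hε _
  refine lesssimZero_of_eventually_le (C := 1 + V)
    (tendsto_log_one_div_nhdsGT_zero.eventually_gt_atTop 0) ?_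
  filter_upwards [self_mem_nhdsWithin, hC,
    tendsto_log_one_div_nhdsGT_zero.eventually_ge_atTop (Real.log (max C 1))]
    with ε (hε : 0 < ε) hCε hlogC
  have hpow : 0 < ε ^ (-V) := Real.rpow_pos_of_pos hε _
  have hle : coveringNum S ε ≤ ENNReal.ofReal (max C 1 * ε ^ (-V)) := by
    rw [← EReal.coe_ennreal_le_coe_ennreal_iff, EReal.coe_ennreal_ofReal,
      max_eq_left (by positivity)]
    refine hCε.trans (EReal.coe_le_coe ?_)
    gcongr
    exact le_max_left C 1
  refine (ENNReal.log_monotone hle).trans ?_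
  rw [ENNReal.log_ofReal_of_pos (by positivity), Real.log_mul (by positivity) hpow.ne',
    Real.log_rpow hε]
  refine EReal.coe_le_coe ?_
  rw [one_div, Real.log_inv] at hlogC ⊢
  linarith

theorem exists_finset_net_of_entropy_range_le {Θ E : Type*} [PseudoMetricSpace E] {ψ : Θ → E}
    {ε B : ℝ} (hε : 0 ≤ ε) (h : entropy (Set.range ψ) ε ≤ B) :
    ∃ S : Finset Θ, (S.card : ℝ) ≤ Real.exp B ∧ ∀ v, ∃ w ∈ S, dist (ψ v) (ψ w) ≤ 2 * ε := by
  classical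
  obtain ⟨C, hCcard, hC⟩ := exists_finset_of_entropy_le hε h
  rcases isEmpty_or_nonempty Θ with _ | _
  · exact ⟨∅, by simpa using (Real.exp_pos B).le, fun v => isEmptyElim v⟩
  have hpick (c : E) : ∃ w, (∃ v, dist (ψ v) c ≤ ε) → dist (ψ w) c ≤ ε := by
    by_cases hc : ∃ v, dist (ψ v) c ≤ ε
    · exact hc.imp fun _ hw _ => hw
    · exact ⟨Classical.arbitrary Θ, fun h => absurd h hc⟩
  choose π hπ using hpick
  refine ⟨C.image π, hCcard.trans' (by exact_mod_cast Finset.card_image_le), fun v => ?_⟩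
  obtain ⟨c, hcC, hvc⟩ := hC _ ⟨v, rfl⟩
  refine ⟨π c, Finset.mem_image_of_mem π hcC, ?_⟩
  linarith [dist_triangle_right (ψ v) (ψ (π c)) c, hπ c ⟨v, hvc⟩]

theorem exists_norm_le_of_lesssimZero_entropy_range {Θ E : Type*} [SeminormedAddCommGroup E]
    {ψ : Θ → E} (h : LesssimZero (entropy (Set.range ψ)) fun ε => Real.log (1 / ε)) :
    ∃ L : ℝ, 0 < L ∧ ∀ v, ‖ψ v‖ ≤ L := by
  obtain ⟨C, hC⟩ :=
    h.exists_eventually_le (tendsto_log_one_div_nhdsGT_zero.eventually_gt_atTop 0)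
  obtain ⟨ε, hεC, hε : 0 < ε⟩ := (hC.and self_mem_nhdsWithin).exists
  obtain ⟨S, -, hS⟩ := exists_finset_net_of_entropy_range_le hε.le hεC
  refine ⟨2 * ε + ∑ w ∈ S, ‖ψ w‖, by positivity, fun v => ?_⟩
  obtain ⟨w, hw, hvw⟩ := hS v
  calc ‖ψ v‖ ≤ ‖ψ v - ψ w‖ + ‖ψ w‖ := norm_le_norm_sub_add _ _
    _ ≤ 2 * ε + ∑ w ∈ S, ‖ψ w‖ := by
      rw [dist_eq_norm] at hvw
      exact add_le_add hvw (Finset.single_le_sum (fun _ _ => norm_nonneg _) hw)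

theorem exists_eventually_geometric_nets {Θ E : Type*} [PseudoMetricSpace E] {ψ : Θ → E}
    (h : LesssimZero (entropy (Set.range ψ)) fun ε => Real.log (1 / ε)) {τ : ℝ} (hτ : 0 < τ)
    (hτ1 : τ < 1) :
    ∃ c : ℝ, 0 ≤ c ∧ ∀ᶠ K : ℕ in atTop, ∃ S : Finset Θ, (S.card : ℝ) ≤ Real.exp (c * K) ∧
      ∀ v, ∃ w ∈ S, dist (ψ v) (ψ w) ≤ 2 * τ ^ K := by
  obtain ⟨C, hC⟩ :=
    h.exists_eventually_le (tendsto_log_one_div_nhdsGT_zero.eventually_gt_atTop 0)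
  have hlogτ : 0 < Real.log (1 / τ) := Real.log_pos (one_lt_one_div hτ hτ1)
  have hpow : Tendsto (fun K : ℕ => τ ^ K) atTop (𝓝[>] 0) :=
    tendsto_nhdsWithin_iff.2 ⟨tendsto_pow_atTop_nhds_zero_of_lt_one hτ.le hτ1,
      Eventually.of_forall fun K => pow_pos hτ K⟩
  refine ⟨|C| * Real.log (1 / τ), by positivity, ?_⟩
  filter_upwards [hpow.eventually hC] with K hK
  refine exists_finset_net_of_entropy_range_le (by positivity)
    (hK.trans (EReal.coe_le_coe ?_))
  rw [← one_div_pow, Real.log_pow, mul_assoc, mul_comm (K : ℝ)]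
  gcongr
  exact le_abs_self C

end LogarithmicEntropy

section HilbertTensor

theorem sqrt_two_mul_two_rpow_neg_inv_eq {W : ℝ} (hW : 0 < W) :
    √2 * (2 : ℝ) ^ (-(2 * W / (2 + W))⁻¹) = 2 ^ (-W⁻¹) := by
  rw [Real.sqrt_eq_rpow, ← Real.rpow_add two_pos]
  congr 1
  field_simp
  ring

theorem IsTensorMap.lesssimZero_entropy_closedAbsConvexHull {Θ H E : Type*} [Nonempty Θ]
    [NormedAddCommGroup H] [InnerProductSpace ℝ H] [NormedAddCommGroup E] [InnerProductSpace ℝ E]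
    {d : ℕ} {T : MultilinearMap ℝ (fun _ : Fin d => H) E} (hT : IsTensorMap T) {ψ : Θ → H}
    (hent : LesssimZero (entropy (Set.range ψ)) fun ε => Real.log (1 / ε))
    {𝒱 : ℕ → Submodule ℝ H} [∀ k, FiniteDimensional ℝ (𝒱 k)] (h𝒱 : Monotone 𝒱) {q : ℕ}
    (hq : ∀ k, Module.finrank ℝ (𝒱 k) ≤ q * 2 ^ k) {L W : ℝ} (hL : 0 < L) (hW : 0 < W)
    (hψ : ∀ v, ‖ψ v‖ ≤ L)
    (happrox : ∀ v k, ∃ g ∈ 𝒱 k, ‖ψ v - g‖ ≤ L * ((2 : ℝ) ^ (-W⁻¹)) ^ k) :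
    LesssimZero
      (entropy (closedAbsConvexHull ℝ (Set.range fun v : Fin d → Θ => T fun i => ψ (v i))))
      (fun ε => ε ^ (-(2 * W / (2 + W))) * Real.log (1 / ε) ^ (d - 1)
        * Real.log (1 / ε) ^ (W / (2 + W))) := by
  set p := 2 * W / (2 + W) with hp_def
  have hp : 0 < p := by positivity
  have hW1 : (2 : ℝ) ^ (-W⁻¹) < 1 :=
    Real.rpow_lt_one_of_one_lt_of_neg one_lt_two (neg_lt_zero.2 (inv_pos.2 hW))
  have hp1 : (2 : ℝ) ^ (-p⁻¹) < 1 :=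
    Real.rpow_lt_one_of_one_lt_of_neg one_lt_two (neg_lt_zero.2 (inv_pos.2 hp))
  rw [← sqrt_two_mul_two_rpow_neg_inv_eq hW] at hW1 happrox
  obtain ⟨c, hc, hnets⟩ := exists_eventually_geometric_nets hent (by positivity) hp1
  simp only [dist_eq_norm] at hnets
  obtain ⟨G, B, hG, hB, hscale⟩ := hT.exists_entropy_closedAbsConvexHull_le h𝒱 hq
    (by positivity) hW1 hL hψ happrox hc
  have hF := lesssimZero_entropy_of_forall_scale hp hG hB.le (d - 1) <|
    (hnets.and (eventually_gt_atTop 0)).mono fun K hK => hscale K hK.2 hK.1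
  rwa [hp_def, mul_div_assoc, mul_div_cancel_left₀ _ two_ne_zero, ← mul_div_assoc] at hF

end HilbertTensor

section LpTensor

theorem norm_sub_sq_eq_integral {μ : Measure ℝ} (f g : Lp ℝ 2 μ) :
    ‖f - g‖ ^ 2 = ∫ u, (f u - g u) ^ 2 ∂μ := by
  rw [← real_inner_self_eq_norm_sq, L2.inner_def]
  refine integral_congr_ae ?_
  filter_upwards [Lp.coeFn_sub f g] with u hu
  rw [hu]
  simp [pow_two]

theorem IsNestedApprox.exists_norm_sub_le {Θ : Type*} {μ : Measure ℝ} {ψ : Θ → Lp ℝ 2 μ} {q : ℕ}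
    {γ W : ℝ} {𝒱 : ℕ → Submodule ℝ (Lp ℝ 2 μ)} (h : IsNestedApprox ψ q γ W 𝒱) {L : ℝ} {v : Θ}
    (hv : ‖ψ v‖ ≤ L) (k : ℕ) :
    ∃ f ∈ 𝒱 k, ‖ψ v - f‖ ≤ max L γ * ((2 : ℝ) ^ (-W⁻¹)) ^ k := by
  rcases k.eq_zero_or_pos with rfl | hk
  · exact ⟨0, zero_mem _, by simpa using Or.inl hv⟩
  obtain ⟨f, hf, hvf⟩ := h.approx k hk v
  have hγ := h.γ_pos
  have hrate : (2 : ℝ) ^ (-(2 * (k : ℝ) / W)) = (((2 : ℝ) ^ (-W⁻¹)) ^ k) ^ 2 := by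
    rw [← pow_mul, ← Real.rpow_mul_natCast zero_le_two]
    push_cast
    ring_nf
  rw [← norm_sub_sq_eq_integral, hrate, ← mul_pow] at hvf
  refine ⟨f, hf, ((sq_le_sq₀ (norm_nonneg _) (by positivity)).1 hvf).trans ?_⟩
  gcongr
  exact le_max_right L γ

theorem IsNestedApprox.finiteDimensional {Θ : Type*} {μ : Measure ℝ} {ψ : Θ → Lp ℝ 2 μ} {q : ℕ}
    {γ W : ℝ} {𝒱 : ℕ → Submodule ℝ (Lp ℝ 2 μ)} (h : IsNestedApprox ψ q γ W 𝒱) (k : ℕ) :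
    FiniteDimensional ℝ (𝒱 k) :=
  Module.finite_of_finrank_pos (h.finrank_eq k ▸ Nat.mul_pos h.q_pos (by positivity))

theorem prod_update_eval {μ : Measure ℝ} {d : ℕ} [DecidableEq (Fin d)] (f : Fin d → Lp ℝ 2 μ)
    (i : Fin d) (x : Lp ℝ 2 μ) (u : Fin d → ℝ) :
    ∏ j, Function.update f i x j (u j) = x (u i) * ∏ j ∈ Finset.univ.erase i, f j (u j) := by
  rw [← Finset.mul_prod_erase _ _ (Finset.mem_univ i), Function.update_self]
  exact congrArg (x (u i) * ·) <| Finset.prod_congr rfl fun j hj => by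
    rw [Function.update_of_ne (Finset.ne_of_mem_erase hj)]

variable (μ : Measure ℝ) [SigmaFinite μ] {d : ℕ}

theorem coeFn_tensor (f : Fin d → Lp ℝ 2 μ) :
    tensor μ f =ᵐ[Measure.pi fun _ : Fin d => μ] fun u => ∏ i, f i (u i) :=
  MemLp.coeFn_toLp _

variable {μ} in
theorem ae_pi_eval {p : ℝ → Prop} (h : ∀ᵐ x ∂μ, p x) (i : Fin d) :
    ∀ᵐ u ∂(Measure.pi fun _ : Fin d => μ), p (u i) :=
  (Measure.quasiMeasurePreserving_eval (fun _ : Fin d => μ) i).ae h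

theorem tensor_update_add [DecidableEq (Fin d)] (f : Fin d → Lp ℝ 2 μ) (i : Fin d)
    (x y : Lp ℝ 2 μ) :
    tensor μ (Function.update f i (x + y)) =
      tensor μ (Function.update f i x) + tensor μ (Function.update f i y) := by
  refine Lp.ext ?_
  filter_upwards [coeFn_tensor μ (Function.update f i (x + y)),
    coeFn_tensor μ (Function.update f i x), coeFn_tensor μ (Function.update f i y),
    Lp.coeFn_add (tensor μ (Function.update f i x)) (tensor μ (Function.update f i y)),
    ae_pi_eval (Lp.coeFn_add x y) i] with u hxy hx hy hadd hadd_i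
  rw [hadd, Pi.add_apply, hxy, hx, hy, prod_update_eval, prod_update_eval, prod_update_eval,
    hadd_i, Pi.add_apply, add_mul]

theorem tensor_update_smul [DecidableEq (Fin d)] (f : Fin d → Lp ℝ 2 μ) (i : Fin d) (c : ℝ)
    (x : Lp ℝ 2 μ) :
    tensor μ (Function.update f i (c • x)) = c • tensor μ (Function.update f i x) := by
  refine Lp.ext ?_
  filter_upwards [coeFn_tensor μ (Function.update f i (c • x)),
    coeFn_tensor μ (Function.update f i x),
    Lp.coeFn_smul c (tensor μ (Function.update f i x)),
    ae_pi_eval (Lp.coeFn_smul c x) i] with u hcx hx hsmul hsmul_i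
  rw [hsmul, Pi.smul_apply, hcx, hx, prod_update_eval, prod_update_eval, hsmul_i, Pi.smul_apply,
    smul_eq_mul, smul_eq_mul, mul_assoc]

/-- The elementary tensor as a multilinear map of its factors. -/
noncomputable def tensorMap (d : ℕ) :
    MultilinearMap ℝ (fun _ : Fin d => Lp ℝ 2 μ) (Lp ℝ 2 (Measure.pi fun _ : Fin d => μ)) where
  toFun := tensor μ
  map_update_add' := tensor_update_add μ
  map_update_smul' := tensor_update_smul μ

theorem isTensorMap_tensorMap : IsTensorMap (tensorMap μ d) := by
  intro f g
  simp only [L2.inner_def]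
  rw [← integral_fintype_prod_eq_prod (μ := fun _ => μ)
    (f := fun i (x : ℝ) => inner ℝ (f i x) (g i x))]
  refine integral_congr_ae ?_
  filter_upwards [coeFn_tensor μ f, coeFn_tensor μ g] with u hf hg
  change inner ℝ (tensor μ f u) (tensor μ g u) = _
  simp [hf, hg, Finset.prod_mul_distrib]

theorem sum_smul_mem_of_absConvex {ι E : Type*} [AddCommGroup E] [Module ℝ E] {S : Set E}
    (hS : AbsConvex ℝ S) (hne : S.Nonempty) {s : Finset ι} {β : ι → ℝ} {x : ι → E}
    (hβ : ∑ i ∈ s, |β i| ≤ 1) (hx : ∀ i ∈ s, x i ∈ S) : ∑ i ∈ s, β i • x i ∈ S := by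
  have hβ0 : 0 ≤ ∑ i ∈ s, |β i| := Finset.sum_nonneg fun _ _ => abs_nonneg _
  rcases hβ0.eq_or_lt with hzero | hpos
  · have hβi := (Finset.sum_eq_zero_iff_of_nonneg fun _ _ => abs_nonneg _).1 hzero.symm
    rw [Finset.sum_eq_zero fun i hi => by rw [abs_eq_zero.1 (hβi i hi), zero_smul]]
    exact hS.1.zero_mem hne
  have hsign (i : ι) (hi : i ∈ s) : (SignType.sign (β i) : ℝ) • x i ∈ S :=
    hS.1.smul_mem (by rcases lt_trichotomy (β i) 0 with h | h | h <;> simp [h]) (hx i hi)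
  have hcenter := hS.2.centerMass_mem (fun i _ => abs_nonneg (β i)) hpos hsign
  have hmem := hS.1.smul_mem (a := ∑ i ∈ s, |β i|) (by rwa [Real.norm_of_nonneg hβ0]) hcenter
  simpa only [Finset.centerMass, smul_inv_smul₀ hpos.ne', smul_smul, abs_mul_sign] using hmem

theorem absconvTensor_subset_closedAbsConvexHull {Θ : Type*} [Nonempty Θ] (ψ : Θ → Lp ℝ 2 μ) :
    absconvTensor μ d ψ ⊆
      closedAbsConvexHull ℝ (Set.range fun v : Fin d → Θ => tensorMap μ d fun i => ψ (v i)) := by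
  rw [closedAbsConvexHull_eq_closure_absConvexHull]
  refine closure_mono ?_
  rintro _ ⟨V, β, hβ, rfl⟩
  exact sum_smul_mem_of_absConvex absConvex_absConvexHull
    ((Set.range_nonempty _).mono subset_absConvexHull) hβ
    fun v _ => subset_absConvexHull ⟨v, rfl⟩

end LpTensor

end TensorEntropy

open TensorEntropy in
theorem mainTheorem4_general {Θ : Type*} [Nonempty Θ] (μ : Measure ℝ) [SigmaFinite μ] (d : ℕ)
    (ψ : Θ → Lp ℝ 2 μ)
    (hent : LesssimZero (entropy (Set.range ψ)) (fun ε => Real.log (1 / ε)))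
    (q : ℕ) (γ W : ℝ) (𝒱 : ℕ → Submodule ℝ (Lp ℝ 2 μ))
    (h𝒱 : IsNestedApprox ψ q γ W 𝒱) :
    LesssimZero
      (entropy (absconvTensor μ d ψ))
      (fun ε => ε ^ (-(2 * W / (2 + W))) * Real.log (1 / ε) ^ (d - 1)
        * Real.log (1 / ε) ^ (W / (2 + W))) := by
  have := h𝒱.finiteDimensional
  obtain ⟨L, hL, hψL⟩ := exists_norm_le_of_lesssimZero_entropy_range hent
  have hF := (isTensorMap_tensorMap (d := d) μ).lesssimZero_entropy_closedAbsConvexHull hent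
    h𝒱.nested (fun k => (h𝒱.finrank_eq k).le) (lt_max_of_lt_left hL) h𝒱.W_pos
    (fun v => (hψL v).trans (le_max_left L γ)) fun v => h𝒱.exists_norm_sub_le (hψL v)
  refine hF.mono_left (fun ε => entropy_mono_set
    (absconvTensor_subset_closedAbsConvexHull μ ψ) ε) ?_
  filter_upwards [self_mem_nhdsWithin,
    tendsto_log_one_div_nhdsGT_zero.eventually_gt_atTop 0] with ε (hε : 0 < ε) hlog
  positivity

theorem mainTheorem4 (μ : MeasureTheory.Measure ℝ) [MeasureTheory.SigmaFinite μ]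
    (d : ℕ) (hd : 1 ≤ d)
    (ψ : Set.Icc (0 : ℝ) 1 → MeasureTheory.Lp ℝ 2 μ) (hψ : ∀ v, ‖ψ v‖ ≤ 1)
    (V : ℝ) (hV : 0 < V)
    (hcov : TensorEntropy.LesssimZero
      (fun ε => (TensorEntropy.coveringNum (Set.range ψ) ε : EReal)) (fun ε => ε ^ (-V)))
    (q : ℕ) (γ W : ℝ) (𝒱 : ℕ → Submodule ℝ (MeasureTheory.Lp ℝ 2 μ))
    (h𝒱 : TensorEntropy.IsNestedApprox ψ q γ W 𝒱) :
    TensorEntropy.LesssimZero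
      (TensorEntropy.entropy (TensorEntropy.absconvTensor μ d ψ))
      (fun ε => ε ^ (-(2 * W / (2 + W))) * Real.log (1 / ε) ^ (d - 1)
        * Real.log (1 / ε) ^ (W / (2 + W))) :=
  mainTheorem4_general μ d ψ
    (TensorEntropy.lesssimZero_entropy_of_lesssimZero_coveringNum hcov) q γ W 𝒱 h𝒱
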